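/- Let $d\in\{2,3\}$ and let $\Omega\subset\mathbb R^d$ be a polygonal/polyhedral domain (only used: $\Omega$ is open and equals the interior of its closure). Let $\mathcal T_h$ be a finite partition of $\overline\Omega$ into closed triangles and/or convex quadrilaterals ($d=2$) or tetrahedra and/or parallelepipeds ($d=3$) with pairwise disjoint interiors; hanging nodes are allowed. Interior edges/faces ($\mathcal F_h^0$) are the intersections $F=K\cap K'$ of two distinct elements with positive $(d-1)$-dimensional measure, boundary edges/faces ($\mathcal F_h^\partial$) are the edges/faces of elements contained in $\partial\Omega$, $\mathcal F_h=\mathcal F_h^0\cup\mathcal F_h^\partial$; each $F\in\mathcal F_h$ is a segment ($d=2$), or a triangle or convex quadrilateral ($d=3$), and $\partial K$ is the union of the set $\mathcal F(K)$ of those $F\in\mathcal F_h$ with $F\subset K$. Write $h_F$ for the diameter of $F$ and $\mathbf n$ for the outward unit normal on $\partial K$. For a cell $D$, $\mathcal P_\ell(D)$ denotes the polynomials on $D$ of degree $\le\ell$ if $D$ is a simplex, and of degree $\le\ell$ in each variable (with respect to some fixed linear coordinates attached to $D$) otherwise; $\mathcal P_\ell(\mathcal T_h)$, $\mathcal P_\ell(\mathcal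 F_h)$ are the piecewise versions. Let $0<\phi<1$, $\nu>1$, $\rho_s,\rho_f,s,\eta,\kappa>0$, $0<\alpha\le1$, $\beta=\eta/\kappa$, $R=\begin{pmatrix}\phi\rho_f+(1-\phi)\rho_s&\rho_f\\ \rho_f&\nu\rho_f/\phi\end{pmatrix}$, and let $\mathcal C$ be a symmetric positive definite linear map on $\mathbb R^{d\times d}_{\rm sym}$. For $k\ge0$ put $\mathcal H_{1,h}=\mathcal P_{k+1}(\mathcal T_h,\mathbb R^{d\times2})$, $\mathcal H_{2,h}=\mathcal P_k(\mathcal T_h,\mathbb R^{d\times d}_{\rm sym})\times\mathcal P_k(\mathcal T_h)$, and $\hat{\mathcal H}_{1,h}=\{[\hat v_s\mid\hat v_f]\in\mathcal P_{k+1}(\mathcal F_h,\mathbb R^{d\times2}):\hat v_s=0\text{ on every }F\in\mathcal F_h^\partial\}$; here $\underline v=[v_s\mid v_f]$. Let $(\underline u,\underline v)_{\mathcal H_1}=(\underline uR,\underline v)_\Omega$, $((\sigma,p),(\tau,q))_{\mathcal H_2}=(\mathcal C^{-1}\sigma,\tau)_\Omega+(sp,q)_\Omega$, $\langle\cdot,\cdot\rangle_{\partial\mathcal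 T_h}=\sum_K\sum_{F\in\mathcal F(K)}\int_F$, and $$B_h((\tau,q),(\underline v,\hat{\underline v}))=(\tau-\alpha qI,\varepsilon(v_s))_{\mathcal T_h}-(q,\operatorname{div}v_f)_{\mathcal T_h}-\langle(\tau-\alpha qI)\mathbf n,v_s-\hat v_s\rangle_{\partial\mathcal T_h}+\langle q\mathbf n,v_f-\hat v_f\rangle_{\partial\mathcal T_h}.$$ Let $T>0$, $\underline F\in C^0([0,T];L^2(\Omega)^{d\times2})$, $g\in C^0([0,T];L^2(\Omega))$. The semi-discrete HDG system asks for $(\underline u_h,\hat{\underline u}_h)\in C^1([0,T];\mathcal H_{1,h}\times\hat{\mathcal H}_{1,h})$ and $(\sigma_h,p_h)\in C^1([0,T];\mathcal H_{2,h})$ such that for all $t\in[0,T]$, $(\underline v,\hat{\underline v})\in\mathcal H_{1,h}\times\hat{\mathcal H}_{1,h}$, $(\tau,q)\in\mathcal H_{2,h}$, $$(\dot{\underline u}_h,\underline v)_{\mathcal H_1}+((\dot\sigma_h,\dot p_h),(\tau,q))_{\mathcal H_2}+(\beta u_{f,h},v_f)_\Omega+B_h((\sigma_h,p_h),(\underline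 v,\hat{\underline v}))-B_h((\tau,q),(\underline u_h,\hat{\underline u}_h))+\Big\langle\tfrac{(k+1)^2}{h_F}(\underline u_h-\hat{\underline u}_h),\underline v-\hat{\underline v}\Big\rangle_{\partial\mathcal T_h}=(\underline F,\underline v)_\Omega+(g,q)_\Omega .\quad(\mathrm{SD})$$ Proposition. The spaces $X=\mathcal H_{1,h}\times\mathcal H_{2,h}$ and $\hat{\mathcal H}_{1,h}$ are finite-dimensional, and there are linear maps $P:X\to\hat{\mathcal H}_{1,h}$ and $A:X\to X$, not depending on $T$ and the data, such that: (i) For $x=(\underline u,\sigma,p)\in X$, $Px$ is the $L^2(\mathcal F_h)$-orthogonal projection onto $\hat{\mathcal H}_{1,h}$ of $\{\!\{\underline u\}\!\}-\frac{h_F}{(k+1)^2}\big[\{\!\{(\sigma-\alpha pI)\mathbf n\}\!\}\mid-\{\!\{p\,\mathbf n\}\!\}\big]$, where $\{\!\{\varphi\}\!\}|_F$ is the mean of the values of $\varphi$ from the elements containing $F$. (ii) For all $T,\underline F,g$ as above there is $b\in C^0([0,T];X)$ such that $C^1$ functions $x=(\underline u_h,\sigma_h,p_h)$, $\hat{\underline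 u}_h$ on $[0,T]$ solve (SD) if and only if $\hat{\underline u}_h(t)=Px(t)$ and $\dot x(t)=Ax(t)+b(t)$ for all $t\in[0,T]$. (iii) For all $\underline u^0\in L^2(\Omega)^{d\times2}$, $\sigma^0\in L^2(\Omega)^{d\times d}_{\rm sym}$, $p^0\in L^2(\Omega)$, system (SD) has exactly one solution with $\underline u_h(0)=\Pi^{k+1}_{\mathcal T}\underline u^0$, $\sigma_h(0)=\Pi^k_{\mathcal T}\sigma^0$, $p_h(0)=\Pi^k_{\mathcal T}p^0$, where $\Pi_{\mathcal T}^\ell$ is the $L^2$-orthogonal projection onto piecewise polynomials. (iv) Let $w\in L^2(\mathcal F_h)^{d\times2}$ (for instance $w=\underline u^0|_{\mathcal F_h}$, if $\underline u^0$ has an $L^2$ trace on the skeleton). If $\hat{\underline u}_h(0)=\Pi^{k+1}_{\mathcal F}w$ is prescribed in addition to the conditions in (iii), where $\Pi^{k+1}_{\mathcal F}$ is the $L^2(\mathcal F_h)$-orthogonal projection onto $\mathcal P_{k+1}(\mathcal F_h)$, then (SD) has exactly one solution if and only if these initial values are compatible with the algebraic part of (SD), that is, $\Pi^{k+1}_{\mathcal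 F}w\in\hat{\mathcal H}_{1,h}$ and $$B_h((\Pi^k_{\mathcal T}\sigma^0,\Pi^k_{\mathcal T}p^0),(0,\hat{\underline v}))-\Big\langle\tfrac{(k+1)^2}{h_F}(\Pi^{k+1}_{\mathcal T}\underline u^0-\Pi^{k+1}_{\mathcal F}w),\hat{\underline v}\Big\rangle_{\partial\mathcal T_h}=0\qquad\forall\,\hat{\underline v}\in\hat{\mathcal H}_{1,h}.$$ -/

import Mathlib

open MeasureTheory Set
open scoped BigOperators ENNReal

noncomputable section

namespace PoroHDG

/-- Points of `ℝ^d` with the Euclidean norm. -/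
abbrev Pt (d : ℕ) := EuclideanSpace ℝ (Fin d)

/-! ### Geometry of the mesh -/

/-- `D` is a nondegenerate closed `m`-simplex (segment, triangle, tetrahedron for `m = 1, 2, 3`). -/
def IsSimplexCell {d : ℕ} (m : ℕ) (D : Set (Pt d)) : Prop :=
  ∃ p : Fin (m + 1) → Pt d, AffineIndependent ℝ p ∧ D = convexHull ℝ (range p)

/-- `D` is a closed (convex, planar, nondegenerate) quadrilateral. -/
def IsQuadrilateral {d : ℕ} (D : Set (Pt d)) : Prop :=
  ∃ p : Fin 4 → Pt d, ConvexIndependent ℝ p ∧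
    Module.finrank ℝ (vectorSpan ℝ (range p)) = 2 ∧ D = convexHull ℝ (range p)

/-- `D` is a closed nondegenerate three-dimensional parallelepiped. -/
def IsParallelepiped {d : ℕ} (D : Set (Pt d)) : Prop :=
  ∃ (a : Pt d) (e : Fin 3 → Pt d), LinearIndependent ℝ e ∧
    D = (fun x => a + x) '' parallelepiped e

/-- The `m`-dimensional cells: simplices, quadrilaterals (`m = 2`), parallelepipeds (`m = 3`). -/
def IsCell {d : ℕ} (m : ℕ) (D : Set (Pt d)) : Prop :=
  IsSimplexCell m D ∨ (m = 2 ∧ IsQuadrilateral D) ∨ (m = 3 ∧ IsParallelepiped D)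

theorem IsCell.isCompact {d m : ℕ} {D : Set (Pt d)} (h : IsCell m D) : IsCompact D := by
  rcases h with ⟨p, -, rfl⟩ | ⟨-, p, -, -, rfl⟩ | ⟨-, a, e, -, rfl⟩
  · exact (finite_range p).isCompact_convexHull ℝ
  · exact (finite_range p).isCompact_convexHull ℝ
  · refine IsCompact.image ?_ (by fun_prop)
    unfold parallelepiped
    exact isCompact_Icc.image (by fun_prop)

/-- `n` is a unit vector and `F` lies in the supporting hyperplane of `K` with outward normal `n`. -/
def IsOutwardNormal {d : ℕ} (K F : Set (Pt d)) (n : Pt d) : Prop :=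
  ‖n‖ = 1 ∧ ∀ x ∈ F, ∀ y ∈ K, inner ℝ n y ≤ inner ℝ n x

/-- `F` is an edge (`d = 2`) or a face (`d = 3`) of the convex cell `K`: the whole contact set of
`K` with a supporting hyperplane, of positive `(d-1)`-dimensional measure. -/
def IsSide {d : ℕ} (K F : Set (Pt d)) : Prop :=
  (∃ n : Pt d, ‖n‖ = 1 ∧ F = {x ∈ K | ∀ y ∈ K, inner ℝ n y ≤ inner ℝ n x}) ∧
    0 < μHE[d - 1] F

/-- The `m` linear forms `c` are linear coordinates on the direction space of `D`. -/
def IsCoordSystem {d m : ℕ} (D : Set (Pt d)) (c : Fin m → (Pt d →L[ℝ] ℝ)) : Prop :=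
  ∀ v ∈ vectorSpan ℝ D, (∀ i, c i v = 0) → v = 0

/-- A partition of `closure Ω` into finitely many closed cells, hanging nodes allowed. An interior
edge/face is an intersection of two distinct elements of positive `(d-1)`-dimensional measure, a
boundary edge/face is an edge/face of an element that lies on `∂Ω`; the edges/faces of the mesh
contained in an element make up the boundary of that element.
The linear coordinates attached to the elements and edges/faces are those in which the degree in
each variable of a polynomial on a quadrilateral or parallelepiped is measured (for instance the
Cartesian coordinates, or the ones along the edges of a parallelepiped). -/
structure Mesh {d : ℕ} (Ω : Set (Pt d)) where
  elems : Finset (Set (Pt d))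
  interiorFaces : Finset (Set (Pt d))
  boundaryFaces : Finset (Set (Pt d))
  isCell_of_mem_elems : ∀ K ∈ elems, IsCell d K
  iUnion_elems : ⋃ K ∈ elems, K = closure Ω
  disjoint_interior : ∀ K ∈ elems, ∀ K' ∈ elems, K ≠ K' → Disjoint (interior K) (interior K')
  mem_interiorFaces : ∀ F, F ∈ interiorFaces ↔
    ∃ K ∈ elems, ∃ K' ∈ elems, K ≠ K' ∧ F = K ∩ K' ∧ 0 < μHE[d - 1] F
  mem_boundaryFaces : ∀ F, F ∈ boundaryFaces ↔
    ∃ K ∈ elems, IsSide K F ∧ F ⊆ frontier Ω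
  isCell_of_mem_faces : ∀ F, F ∈ interiorFaces ∨ F ∈ boundaryFaces → IsCell (d - 1) F
  frontier_subset : ∀ K ∈ elems, ∀ x ∈ frontier K,
    ∃ F, (F ∈ interiorFaces ∨ F ∈ boundaryFaces) ∧ F ⊆ K ∧ x ∈ F
  elemCoord : Set (Pt d) → Fin d → (Pt d →L[ℝ] ℝ)
  faceCoord : Set (Pt d) → Fin (d - 1) → (Pt d →L[ℝ] ℝ)
  elemCoord_spec : ∀ K ∈ elems, IsCoordSystem K (elemCoord K)
  faceCoord_spec : ∀ F, F ∈ interiorFaces ∨ F ∈ boundaryFaces → IsCoordSystem F (faceCoord F)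

/-! ### Polynomial spaces -/

/-- The function `x ↦ q (c₁ x, …, c_m x)` on `D`. -/
def polyEval {d m : ℕ} (D : Set (Pt d)) (c : Fin m → (Pt d →L[ℝ] ℝ)) :
    MvPolynomial (Fin m) ℝ →ₗ[ℝ] C(D, ℝ) where
  toFun q := ⟨fun x => MvPolynomial.eval (fun i => c i x.1) q, by
    refine (MvPolynomial.continuous_eval q).comp ?_
    fun_prop⟩
  map_add' p q := by ext x; simp
  map_smul' r q := by ext x; simp

open Classical in
/-- The polynomials on the `m`-dimensional cell `D`, as continuous functions on `D`: of total degree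
at most `ℓ` on a simplex, of degree at most `ℓ` in each variable on any other cell. -/
def polySpace {d m : ℕ} (ℓ : ℕ) (D : Set (Pt d)) (c : Fin m → (Pt d →L[ℝ] ℝ)) :
    Submodule ℝ C(D, ℝ) :=
  if IsSimplexCell m D then (MvPolynomial.restrictTotalDegree (Fin m) ℝ ℓ).map (polyEval D c)
  else (MvPolynomial.restrictDegree (Fin m) ℝ ℓ).map (polyEval D c)

open Classical in
/-- The extension by zero to `ℝ^d` of a function given on `D`. -/
def ev {d : ℕ} {D : Set (Pt d)} (f : C(D, ℝ)) (x : Pt d) : ℝ :=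
  if h : x ∈ D then f ⟨x, h⟩ else 0

/-- The partial derivative `∂_j f` on `D`. -/
def pderivOn {d : ℕ} {D : Set (Pt d)} (f : C(D, ℝ)) (j : Fin d) (x : Pt d) : ℝ :=
  fderivWithin ℝ (ev f) D x (EuclideanSpace.single j 1)

/-! ### Coefficients of the model -/

/-- Symmetric `d × d` matrices. -/
def symMat (d : ℕ) : Submodule ℝ (Matrix (Fin d) (Fin d) ℝ) where
  carrier := {A | ∀ i j, A i j = A j i}
  add_mem' := fun {A B} hA hB i j => by simp [Matrix.add_apply, hA i j, hB i j]
  zero_mem' := fun i j => rfl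
  smul_mem' := fun c A hA i j => by simp [Matrix.smul_apply, hA i j]

/-- `A : B = ∑_{ij} A_ij B_ij`. -/
def frob {d : ℕ} (A B : symMat d) : ℝ := ∑ i, ∑ j, A.1 i j * B.1 i j

/-- The physical coefficients of the dynamic Biot model: porosity `φ`, tortuosity `ν`, solid and fluid
densities, Biot-Willis parameter `α`, viscosity `η`, permeability `κ`, storage coefficient `s`, and
the symmetric positive definite stiffness tensor `C`. -/
structure BiotCoeff (d : ℕ) where
  (φ ν ρs ρf α η κ s : ℝ)
  φ_pos : 0 < φ
  φ_lt_one : φ < 1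
  one_lt_ν : 1 < ν
  ρs_pos : 0 < ρs
  ρf_pos : 0 < ρf
  α_pos : 0 < α
  α_le_one : α ≤ 1
  η_pos : 0 < η
  κ_pos : 0 < κ
  s_pos : 0 < s
  C : symMat d →ₗ[ℝ] symMat d
  C_symm : ∀ A B, frob (C A) B = frob A (C B)
  C_pos : ∀ A, A ≠ 0 → 0 < frob (C A) A

namespace BiotCoeff

variable {d : ℕ} (c : BiotCoeff d)

/-- The density interaction matrix. -/
def R : Matrix (Fin 2) (Fin 2) ℝ :=
  !![c.φ * c.ρf + (1 - c.φ) * c.ρs, c.ρf; c.ρf, c.ν / c.φ * c.ρf]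

def β : ℝ := c.η / c.κ

theorem C_injective : Function.Injective c.C := by
  rw [injective_iff_map_eq_zero]
  intro A hA
  by_contra h
  have := c.C_pos A h
  rw [hA] at this
  simp [frob] at this

instance : FiniteDimensional ℝ (symMat d) :=
  FiniteDimensional.finiteDimensional_submodule _

/-- The compliance tensor, the inverse of `C`. -/
def compliance : symMat d ≃ₗ[ℝ] symMat d :=
  (LinearEquiv.ofInjectiveEndo c.C c.C_injective).symm

end BiotCoeff

namespace Mesh

variable {d : ℕ} {Ω : Set (Pt d)} (M : Mesh Ω)

/-- The set of all edges/faces. -/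
def faces : Set (Set (Pt d)) := {F | F ∈ M.interiorFaces ∨ F ∈ M.boundaryFaces}

abbrev Elem := {K // K ∈ M.elems}

abbrev Face := {F // F ∈ M.faces}

instance : Finite M.Face :=
  ((M.interiorFaces.finite_toSet.union M.boundaryFaces.finite_toSet).subset
    (fun _ h => h) : M.faces.Finite)

instance : Fintype M.Face := Fintype.ofFinite _

instance (K : M.Elem) : CompactSpace (K : Set (Pt d)) :=
  isCompact_iff_compactSpace.mp (M.isCell_of_mem_elems K.1 K.2).isCompact

instance (F : M.Face) : CompactSpace (F : Set (Pt d)) :=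
  isCompact_iff_compactSpace.mp (M.isCell_of_mem_faces F.1 F.2).isCompact

/-- Scalar functions that are continuous on each element (and double-valued on the skeleton). All
norms on its finite-dimensional subspaces of piecewise polynomials are equivalent. -/
abbrev Broken := ∀ K : M.Elem, C((K : Set (Pt d)), ℝ)

/-- Scalar functions on the skeleton that are continuous (and single-valued) on each edge/face. -/
abbrev Skel := ∀ F : M.Face, C((F : Set (Pt d)), ℝ)

/-- Polynomials of degree `ℓ` on an element. -/
def elemPoly (ℓ : ℕ) (K : M.Elem) : Submodule ℝ C((K : Set (Pt d)), ℝ) :=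
  polySpace ℓ K.1 (M.elemCoord K.1)

/-- Polynomials of degree `ℓ` on an edge/face. -/
def facePoly (ℓ : ℕ) (F : M.Face) : Submodule ℝ C((F : Set (Pt d)), ℝ) :=
  polySpace ℓ F.1 (M.faceCoord F.1)

open Classical in
/-- The edges/faces composing an element. -/
def facesOf (K : M.Elem) : Finset M.Face :=
  Finset.univ.filter fun F => (F : Set (Pt d)) ⊆ (K : Set (Pt d))

open Classical in
/-- The elements adjacent to an edge/face: two if it is interior, one if it is on the boundary. -/
def elemsOf (F : M.Face) : Finset M.Elem :=
  Finset.univ.filter fun K => (F : Set (Pt d)) ⊆ (K : Set (Pt d))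

/-- The outward unit normal vector of the element `K` on its edge/face `F`. -/
def normal (K : M.Elem) (F : M.Face) : Pt d :=
  Classical.epsilon fun n => IsOutwardNormal (K : Set (Pt d)) (F : Set (Pt d)) n

/-- The diameter of an edge/face. -/
def hF (F : M.Face) : ℝ := Metric.diam (F : Set (Pt d))

/-- Discrete velocities `[u_s | u_f]` (column `0` is solid, column `1` is fluid), piecewise
polynomials of degree `k + 1`. -/
def velSpace (k : ℕ) : Submodule ℝ (Fin 2 → Fin d → M.Broken) where
  carrier := {v | ∀ a i K, v a i K ∈ M.elemPoly (k + 1) K}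
  add_mem' := fun hu hv a i K => Submodule.add_mem _ (hu a i K) (hv a i K)
  zero_mem' := fun _ _ _ => Submodule.zero_mem _
  smul_mem' := fun r _ hv a i K => Submodule.smul_mem _ r (hv a i K)

/-- Discrete velocity traces `[û_s | û_f]`, piecewise polynomials of degree `k + 1` on the skeleton,
with `û_s = 0` on the boundary. -/
def traceSpace (k : ℕ) : Submodule ℝ (Fin 2 → Fin d → M.Skel) where
  carrier := {v | (∀ a i F, v a i F ∈ M.facePoly (k + 1) F) ∧
    ∀ i (F : M.Face), F.1 ∈ M.boundaryFaces → v 0 i F = 0}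
  add_mem' := fun {u v} hu hv => ⟨fun a i F => Submodule.add_mem _ (hu.1 a i F) (hv.1 a i F),
    fun i F hF => by
      change u 0 i F + v 0 i F = 0
      rw [hu.2 i F hF, hv.2 i F hF, add_zero]⟩
  zero_mem' := ⟨fun _ _ _ => Submodule.zero_mem _, fun _ _ _ => rfl⟩
  smul_mem' := fun r v hv => ⟨fun a i F => Submodule.smul_mem _ r (hv.1 a i F),
    fun i F hF => by
      change r • v 0 i F = 0
      rw [hv.2 i F hF, smul_zero]⟩

/-- Discrete stress (symmetric) and pressure, piecewise polynomials of degree `k`. -/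
def stressSpace (k : ℕ) : Submodule ℝ ((Fin d → Fin d → M.Broken) × M.Broken) where
  carrier := {τ | (∀ i j K, τ.1 i j K ∈ M.elemPoly k K) ∧ (∀ K, τ.2 K ∈ M.elemPoly k K) ∧
    ∀ i j, τ.1 i j = τ.1 j i}
  add_mem' := fun {σ τ} hσ hτ =>
    ⟨fun i j K => Submodule.add_mem _ (hσ.1 i j K) (hτ.1 i j K),
      fun K => Submodule.add_mem _ (hσ.2.1 K) (hτ.2.1 K), fun i j => by
        change σ.1 i j + τ.1 i j = σ.1 j i + τ.1 j i
        rw [hσ.2.2 i j, hτ.2.2 i j]⟩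
  zero_mem' := ⟨fun _ _ _ => Submodule.zero_mem _, fun _ => Submodule.zero_mem _, fun _ _ => rfl⟩
  smul_mem' := fun r τ hτ => ⟨fun i j K => Submodule.smul_mem _ r (hτ.1 i j K),
      fun K => Submodule.smul_mem _ r (hτ.2.1 K), fun i j => by
        change r • τ.1 i j = r • τ.1 j i
        rw [hτ.2.2 i j]⟩

/-- The differential unknowns `(u_h, (σ_h, p_h))`. -/
abbrev Core (k : ℕ) := M.velSpace k × M.stressSpace k

/-- All unknowns `((u_h, (σ_h, p_h)), û_h)`. -/
abbrev Unknown (k : ℕ) := M.Core k × M.traceSpace k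

variable {M} {k : ℕ}

/-- The value at `x` of the discrete stress on the element `K`. -/
def stressAt (τ : M.stressSpace k) (K : M.Elem) (x : Pt d) : symMat d :=
  ⟨Matrix.of fun i j => ev (τ.1.1 i j K) x, fun i j => by simp [τ.2.2.2 i j]⟩

/-- The total stress `(τ - α q I)_{ij}` on the element `K`. -/
def totalStress (c : BiotCoeff d) (τ : M.stressSpace k) (K : M.Elem) (i j : Fin d)
    (x : Pt d) : ℝ :=
  ev (τ.1.1 i j K) x - c.α * ev (τ.1.2 K) x * (if i = j then 1 else 0)

/-- `ε(v_s)_{ij}` on the element `K`. -/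
def strain (v : M.velSpace k) (K : M.Elem) (i j : Fin d) (x : Pt d) : ℝ :=
  (pderivOn (v.1 0 i K) j x + pderivOn (v.1 0 j K) i x) / 2

/-- `div v_f` on the element `K`. -/
def divFluid (v : M.velSpace k) (K : M.Elem) (x : Pt d) : ℝ :=
  ∑ i, pderivOn (v.1 1 i K) i x

/-- `(u, v)_{H₁} = (u R, v)_Ω`. -/
def innerH1 (c : BiotCoeff d) (u v : M.velSpace k) : ℝ :=
  ∑ K : M.Elem, ∫ x in K.1, ∑ i, ∑ b, (∑ a, ev (u.1 a i K) x * c.R a b) * ev (v.1 b i K) x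

/-- `((σ, p), (τ, q))_{H₂} = (C⁻¹ σ, τ)_Ω + (s p, q)_Ω`. -/
def innerH2 (c : BiotCoeff d) (σ τ : M.stressSpace k) : ℝ :=
  ∑ K : M.Elem, ∫ x in K.1,
    (frob (c.compliance (stressAt σ K x)) (stressAt τ K x)
      + c.s * ev (σ.1.2 K) x * ev (τ.1.2 K) x)

/-- `(β u_f, v_f)_Ω`. -/
def damping (c : BiotCoeff d) (u v : M.velSpace k) : ℝ :=
  ∑ K : M.Elem, ∫ x in K.1, c.β * ∑ i, ev (u.1 1 i K) x * ev (v.1 1 i K) x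

/-- The bilinear form `B_h((τ, q), (v, v̂))`. -/
def Bh (c : BiotCoeff d) (τ : M.stressSpace k) (v : M.velSpace k) (vh : M.traceSpace k) : ℝ :=
  (∑ K : M.Elem, ∫ x in K.1, ∑ i, ∑ j, totalStress c τ K i j x * strain v K i j x)
  - (∑ K : M.Elem, ∫ x in K.1, ev (τ.1.2 K) x * divFluid v K x)
  - (∑ K : M.Elem, ∑ F ∈ M.facesOf K, ∫ x in F.1,
      ∑ i, (∑ j, totalStress c τ K i j x * M.normal K F j)
        * (ev (v.1 0 i K) x - ev (vh.1 0 i F) x) ∂μHE[d - 1])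
  + (∑ K : M.Elem, ∑ F ∈ M.facesOf K, ∫ x in F.1,
      ∑ i, (ev (τ.1.2 K) x * M.normal K F i)
        * (ev (v.1 1 i K) x - ev (vh.1 1 i F) x) ∂μHE[d - 1])

/-- The stabilization `⟨(k+1)² / h_F (u - û), v - v̂⟩_{∂T_h}`. -/
def stab (u : M.velSpace k) (uh : M.traceSpace k) (v : M.velSpace k) (vh : M.traceSpace k) : ℝ :=
  ∑ K : M.Elem, ∑ F ∈ M.facesOf K, ((k : ℝ) + 1) ^ 2 / M.hF F *
    ∫ x in F.1, ∑ a, ∑ i, (ev (u.1 a i K) x - ev (uh.1 a i F) x)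
      * (ev (v.1 a i K) x - ev (vh.1 a i F) x) ∂μHE[d - 1]

/-- Scalar `L²` functions on `Ω`. -/
abbrev L2 (Ω : Set (Pt d)) := Lp ℝ 2 (volume.restrict Ω)

/-- The load `(F, v)_Ω + (g, q)_Ω`. -/
def load (f : Fin 2 → Fin d → L2 Ω) (g : L2 Ω) (v : M.velSpace k) (τ : M.stressSpace k) : ℝ :=
  (∑ K : M.Elem, ∫ x in Ω ∩ K.1, ∑ a, ∑ i, f a i x * ev (v.1 a i K) x)
  + ∑ K : M.Elem, ∫ x in Ω ∩ K.1, g x * ev (τ.1.2 K) x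

/-- `y` is a solution in `C¹([0,T])` of the semi-discrete HDG system. -/
def SolvesHDG (c : BiotCoeff d) (T : ℝ) (f : ℝ → Fin 2 → Fin d → L2 Ω) (g : ℝ → L2 Ω)
    (y : ℝ → M.Unknown k) : Prop :=
  ContDiffOn ℝ 1 y (Icc 0 T) ∧
  ∀ t ∈ Icc 0 T, ∀ (v : M.velSpace k) (vh : M.traceSpace k) (τ : M.stressSpace k),
    innerH1 c (derivWithin (fun r => (y r).1.1) (Icc 0 T) t) v
    + innerH2 c (derivWithin (fun r => (y r).1.2) (Icc 0 T) t) τ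
    + damping c (y t).1.1 v
    + Bh c (y t).1.2 v vh - Bh c τ (y t).1.1 (y t).2
    + stab (y t).1.1 (y t).2 v vh
    = load (f t) (g t) v τ

/-- `p` is the `L²(K)`-orthogonal projection of `w` onto the polynomials of degree `ℓ`. -/
def IsElemProj (ℓ : ℕ) (K : M.Elem) (w : L2 Ω) (p : C((K : Set (Pt d)), ℝ)) : Prop :=
  p ∈ M.elemPoly ℓ K ∧
  ∀ q ∈ M.elemPoly ℓ K, ∫ x in K.1, ev p x * ev q x = ∫ x in Ω ∩ K.1, w x * ev q x

/-- `p` is the `L²(F)`-orthogonal projection of `w` onto the polynomials of degree `ℓ`. -/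
def IsFaceProj (ℓ : ℕ) (F : M.Face) (w : Lp ℝ 2 ((μHE[d - 1] : Measure (Pt d)).restrict F.1))
    (p : C((F : Set (Pt d)), ℝ)) : Prop :=
  p ∈ M.facePoly ℓ F ∧
  ∀ q ∈ M.facePoly ℓ F, ∫ x in F.1, ev p x * ev q x ∂μHE[d - 1]
    = ∫ x in F.1, w x * ev q x ∂μHE[d - 1]

/-- `u = Π^{k+1} u⁰`, `σ = Π^k σ⁰`, `p = Π^k p⁰`. -/
def IsCoreProj (u0 : Fin 2 → Fin d → L2 Ω) (σ0 : Fin d → Fin d → L2 Ω) (p0 : L2 Ω)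
    (x : M.Core k) : Prop :=
  (∀ a i K, IsElemProj (k + 1) K (u0 a i) (x.1.1 a i K)) ∧
  (∀ i j K, IsElemProj k K (σ0 i j) (x.2.1.1 i j K)) ∧
  ∀ K, IsElemProj k K p0 (x.2.1.2 K)

variable (M) in
/-- Matrix-valued `L²` functions (with values in `ℝ^{d×2}`) on the skeleton. -/
abbrev SkelL2 := Fin 2 → Fin d → ∀ F : M.Face, Lp ℝ 2 ((μHE[d - 1] : Measure (Pt d)).restrict F.1)

/-- `û = Π_F^{k+1} w` on the skeleton. -/
def IsSkelProj (w : M.SkelL2) (uh : M.traceSpace k) : Prop :=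
  ∀ a i F, IsFaceProj (k + 1) F (w a i F) (uh.1 a i F)

/-- The algebraic part of the semi-discrete system: the equation tested with `v = 0`, `(τ, q) = 0`. -/
def TraceEquation (c : BiotCoeff d) (x : M.Core k) (uh : M.traceSpace k) : Prop :=
  ∀ vh : M.traceSpace k, Bh c x.2 0 vh + stab x.1 uh 0 vh = 0

/-- The mean over the elements adjacent to `F` of a quantity given on each of them; this is
`(φ|_K + φ|_{K'}) / 2` on an interior edge/face and `φ|_K` on a boundary edge/face. -/
def mean (F : M.Face) (φ : M.Elem → ℝ) : ℝ :=
  (∑ K ∈ M.elemsOf F, φ K) / ((M.elemsOf F).card : ℝ)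

/-- The averaged quantity `{u} - h_F/(k+1)² [ {(σ - α p I) n} | -{p n} ]` at the point `x` of `F`.
(The value of its solid column on boundary edges/faces is irrelevant: all elements of the trace
space vanish there.) -/
def averaged (c : BiotCoeff d) (y : M.Core k) (a : Fin 2) (i : Fin d) (F : M.Face)
    (x : Pt d) : ℝ :=
  mean F (fun K => ev (y.1.1 a i K) x) - M.hF F / ((k : ℝ) + 1) ^ 2 *
    (if a = 0 then mean F (fun K => ∑ j, totalStress c y.2 K i j x * M.normal K F j)
      else - mean F (fun K => ev (y.2.1.2 K) x * M.normal K F i))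

/-- `uh` is the `L²(F_h)`-orthogonal projection of the averaged quantity onto the trace space. -/
def IsTraceProj (c : BiotCoeff d) (y : M.Core k) (uh : M.traceSpace k) : Prop :=
  ∀ vh : M.traceSpace k,
    ∑ F : M.Face, ∫ x in F.1, ∑ a, ∑ i, ev (uh.1 a i F) x * ev (vh.1 a i F) x ∂μHE[d - 1]
    = ∑ F : M.Face, ∫ x in F.1, ∑ a, ∑ i, averaged c y a i F x * ev (vh.1 a i F) x ∂μHE[d - 1]

end Mesh

end PoroHDG

end

open MeasureTheory Set
open scoped BigOperators ENNReal

noncomputable section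

/-! ### Linear ODEs with continuous forcing -/

namespace PoroHDG

/-! The time derivative of the trace never appears in (SD), so the trace can be eliminated and what
remains is a linear ODE in a finite-dimensional space.

Split every test function as `(0, v̂, 0) + (v, 0, (τ, q))`. The first summand gives the algebraic
part of (SD). A trace is single-valued on each face, so summing over the elements adjacent to `F`
turns the integrand into a negative constant times (averaged quantity minus trace) times `v̂`
(`algebraic_integrand_eq`). The constants depend on the face, but the trace space is stable under
facewise scaling, so they can be absorbed into the test function. The algebraic part therefore says
exactly that the trace is the unweighted `L²` projection `P x` (`traceEquation_iff`).

With the trace replaced by `P x`, the second summand reads `coreForm ẋ z = load z - reducedForm x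
z`. The form `coreForm` is definite: the density matrix, the compliance tensor and `s` are positive,
and a nonnegative continuous function with zero integral over a cell vanishes on it. The latter
rests on `euclideanHausdorffMeasure_convex`, which also covers the lower-dimensional faces.
Inverting `coreForm` gives `ẋ = A x + b` (`system_iff`, `solvesHDG_iff`), with `b` continuous
because the load is continuous in time when tested with each fixed `z`.

Existence for this ODE is Duhamel's formula and uniqueness is Grönwall's inequality. The initial
trace is thus forced to be `P x(0)`, so prescribing it as well is possible exactly when the
prescribed value satisfies the algebraic equation. -/

theorem exists_solution_linear_ode {E : Type*} [NormedAddCommGroup E] [NormedSpace ℝ E]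
    [CompleteSpace E] (A : E →L[ℝ] E) {T : ℝ} (hT : 0 ≤ T) {b : ℝ → E}
    (hb : ContinuousOn b (Icc 0 T)) (x₀ : E) :
    ∃ x : ℝ → E, x 0 = x₀ ∧ ∀ t ∈ Icc 0 T, HasDerivWithinAt x (A (x t) + b t) (Icc 0 T) t := by
  -- Extending `b` by its end values makes the forcing continuous on all of `ℝ`, so the fundamental
  -- theorem of calculus applies at the end points too.
  let b' : ℝ → E := IccExtend hT ((Icc 0 T).domRestrict b)
  have hb' : Continuous b' := (continuousOn_iff_continuous_domRestrict.1 hb).Icc_extend'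
  have hbb : ∀ t ∈ Icc 0 T, b' t = b t := fun t ht => by
    simp [b', IccExtend_of_mem hT _ ht, Set.domRestrict]
  let e : ℝ → E →L[ℝ] E := fun t => NormedSpace.exp (t • A)
  have he : ∀ t, HasDerivAt e (A * e t) t := fun t => hasDerivAt_exp_smul_const' A t
  have hec : Continuous e := continuous_iff_continuousAt.2 fun t => (he t).continuousAt
  have hinv : ∀ t, e t * e (-t) = 1 := fun t => by
    let _ : NormedAlgebra ℚ (E →L[ℝ] E) := NormedAlgebra.restrictScalars ℚ ℝ _
    simp only [e]
    rw [← NormedSpace.exp_add_of_commute, ← add_smul, add_neg_cancel, zero_smul,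
      NormedSpace.exp_zero]
    exact ((Commute.refl A).smul_left t).smul_right (-t)
  let c : ℝ → E := fun s => e (-s) (b' s)
  have hc : Continuous c := (hec.comp continuous_neg).clm_apply hb'
  -- Variation of constants: `x t = exp (tA) (x₀ + ∫₀ᵗ exp (-sA) b s ds)`.
  refine ⟨fun t => e t (x₀ + ∫ s in (0 : ℝ)..t, c s), by simp [e], fun t ht => ?_⟩
  have h1 : HasDerivAt (fun u => x₀ + ∫ s in (0 : ℝ)..u, c s) (c t) t :=
    (intervalIntegral.integral_hasDerivAt_right (hc.intervalIntegrable _ _)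
      (hc.stronglyMeasurableAtFilter _ _) hc.continuousAt).const_add _
  have h2 := (he t).clm_apply h1
  have h3 : e t (c t) = b t := by
    rw [← hbb t ht]
    change (e t * e (-t)) (b' t) = b' t
    rw [hinv]
    rfl
  rw [h3] at h2
  exact h2.hasDerivWithinAt

theorem eqOn_of_linear_ode {E : Type*} [NormedAddCommGroup E] [NormedSpace ℝ E]
    (A : E →L[ℝ] E) {T : ℝ} {b x y : ℝ → E}
    (hx : ∀ t ∈ Icc 0 T, HasDerivWithinAt x (A (x t) + b t) (Icc 0 T) t)
    (hy : ∀ t ∈ Icc 0 T, HasDerivWithinAt y (A (y t) + b t) (Icc 0 T) t) (h0 : x 0 = y 0) :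
    EqOn x y (Icc 0 T) := by
  -- Grönwall uniqueness asks for right derivatives on `[0, T)`; these follow from the derivatives
  -- within `[0, T]`.
  have hI : ∀ {z : ℝ → E}, (∀ t ∈ Icc 0 T, HasDerivWithinAt z (A (z t) + b t) (Icc 0 T) t) →
      ∀ t ∈ Ico 0 T, HasDerivWithinAt z (A (z t) + b t) (Ici t) t := fun hz t ht =>
    ((hz t ⟨ht.1, ht.2.le⟩).mono (Icc_subset_Icc_left ht.1)).mono_of_mem_nhdsWithin
      (Icc_mem_nhdsGE ht.2)
  refine ODE_solution_unique_of_mem_Icc_right (v := fun t z => A z + b t) (s := fun _ => univ)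
    (K := ‖A‖₊) (fun t _ => ?_) (fun t ht => (hx t ht).continuousWithinAt) (hI hx)
    (fun _ _ => mem_univ _) (fun t ht => (hy t ht).continuousWithinAt) (hI hy)
    (fun _ _ => mem_univ _) h0
  have := A.lipschitz.add (LipschitzWith.const (b t))
  rw [add_zero] at this
  exact this.lipschitzOnWith

/-- The derivative equals `A x + b`, which is continuous as soon as `x` is. The assumption `0 < T`
makes derivatives within `[0, T]` unique. -/
theorem contDiffOn_of_linear_ode {E : Type*} [NormedAddCommGroup E] [NormedSpace ℝ E]
    (A : E →L[ℝ] E) {T : ℝ} (hT : 0 < T) {b x : ℝ → E} (hb : ContinuousOn b (Icc 0 T))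
    (hx : ∀ t ∈ Icc 0 T, HasDerivWithinAt x (A (x t) + b t) (Icc 0 T) t) :
    ContDiffOn ℝ 1 x (Icc 0 T) := by
  have hu := uniqueDiffOn_Icc hT
  have hc : ContinuousOn x (Icc 0 T) := fun t ht => (hx t ht).continuousWithinAt
  rw [contDiffOn_one_iff_derivWithin hu]
  refine ⟨fun t ht => (hx t ht).differentiableWithinAt, ?_⟩
  exact ((A.continuous.comp_continuousOn hc).add hb).congr fun t ht =>
    (hx t ht).derivWithin (hu t ht)

/-- The weak system differentiates velocity and stress separately, the ODE differentiates the pair.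
This provides one vector `dx` that serves both, and turns `HasDerivWithinAt` into an equation. -/
theorem exists_derivWithin_components {E₁ E₂ E₃ : Type*} [NormedAddCommGroup E₁]
    [NormedSpace ℝ E₁] [NormedAddCommGroup E₂] [NormedSpace ℝ E₂] [NormedAddCommGroup E₃]
    [NormedSpace ℝ E₃] {T : ℝ} (hT : 0 < T) {y : ℝ → (E₁ × E₂) × E₃}
    (hy : ContDiffOn ℝ 1 y (Icc 0 T)) {t : ℝ} (ht : t ∈ Icc 0 T) :
    ∃ dx : E₁ × E₂,
      (∀ z, HasDerivWithinAt (fun r => (y r).1) z (Icc 0 T) t ↔ dx = z) ∧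
      derivWithin (fun r => (y r).1.1) (Icc 0 T) t = dx.1 ∧
      derivWithin (fun r => (y r).1.2) (Icc 0 T) t = dx.2 := by
  have hu : UniqueDiffWithinAt ℝ (Icc 0 T) t := uniqueDiffOn_Icc hT t ht
  have h1 := (hy.differentiableOn one_ne_zero t ht).fst.hasDerivWithinAt
  have h2 : HasDerivWithinAt (fun r => (y r).1.1) _ (Icc 0 T) t :=
    hasFDerivAt_fst.comp_hasDerivWithinAt t h1
  have h3 : HasDerivWithinAt (fun r => (y r).1.2) _ (Icc 0 T) t :=
    hasFDerivAt_snd.comp_hasDerivWithinAt t h1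
  exact ⟨_, fun z => ⟨fun h => h.derivWithin hu, fun h => h ▸ h1⟩, h2.derivWithin hu,
    h3.derivWithin hu⟩

/-- The second component inherits `C¹` regularity from the first because `P` is linear on a
finite-dimensional space. -/
theorem existsUnique_solution_of_linear_ode {E F : Type*} [NormedAddCommGroup E]
    [NormedSpace ℝ E] [FiniteDimensional ℝ E] [NormedAddCommGroup F] [NormedSpace ℝ F]
    (A : E →ₗ[ℝ] E) (P : E →ₗ[ℝ] F) {T : ℝ} (hT : 0 < T) {b : ℝ → E}
    (hb : ContinuousOn b (Icc 0 T)) (x₀ : E) :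
    ∃ y : ℝ → E × F, ContDiffOn ℝ 1 y (Icc 0 T) ∧
      (∀ t ∈ Icc 0 T, (y t).2 = P (y t).1 ∧
        HasDerivWithinAt (fun r => (y r).1) (A (y t).1 + b t) (Icc 0 T) t) ∧
      (y 0).1 = x₀ ∧
      ∀ y' : ℝ → E × F, (∀ t ∈ Icc 0 T, (y' t).2 = P (y' t).1 ∧
        HasDerivWithinAt (fun r => (y' r).1) (A (y' t).1 + b t) (Icc 0 T) t) →
        (y' 0).1 = x₀ → EqOn y' y (Icc 0 T) := by
  have : CompleteSpace E := FiniteDimensional.complete ℝ E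
  let A' : E →L[ℝ] E := LinearMap.toContinuousLinearMap A
  let P' : E →L[ℝ] F := LinearMap.toContinuousLinearMap P
  obtain ⟨x, hx0, hx⟩ := exists_solution_linear_ode A' hT.le hb x₀
  have hxc := contDiffOn_of_linear_ode A' hT hb hx
  refine ⟨fun t => (x t, P' (x t)), hxc.prodMk (P'.contDiff.comp_contDiffOn hxc),
    fun t ht => ⟨rfl, hx t ht⟩, hx0, fun y' h h0 t ht => ?_⟩
  have h2 : (y' t).1 = x t := eqOn_of_linear_ode A' (x := fun r => (y' r).1)
    (fun t ht => (h t ht).2) hx (h0.trans hx0.symm) ht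
  exact Prod.ext h2 ((h t ht).1.trans (congrArg P h2))

/-! ### Representation of functionals by definite bilinear forms -/

/-- Definiteness makes `G : V → V*` injective, hence bijective by dimension, and `Q = G⁻¹ ∘ L`. No
symmetry is needed. -/
theorem exists_linearMap_of_definite {V W : Type*} [AddCommGroup V] [Module ℝ V]
    [FiniteDimensional ℝ V] [AddCommGroup W] [Module ℝ W] (G : V →ₗ[ℝ] V →ₗ[ℝ] ℝ)
    (hG : ∀ v, G v v = 0 → v = 0) (L : W →ₗ[ℝ] V →ₗ[ℝ] ℝ) :
    ∃ Q : W →ₗ[ℝ] V, ∀ w v, G (Q w) v = L w v := by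
  have hinj : Function.Injective G := by
    rw [injective_iff_map_eq_zero]
    intro v hv
    exact hG v (by rw [hv]; rfl)
  let e : V ≃ₗ[ℝ] (V →ₗ[ℝ] ℝ) :=
    LinearEquiv.ofInjectiveOfFinrankEq G hinj (Subspace.dual_finrank_eq).symm
  refine ⟨e.symm.toLinearMap ∘ₗ L, fun w v => ?_⟩
  have : e (e.symm (L w)) = L w := e.apply_symm_apply _
  exact congrArg (fun ℓ : V →ₗ[ℝ] ℝ => ℓ v) this

theorem eq_of_definite {V : Type*} [AddCommGroup V] [Module ℝ V]
    (G : V →ₗ[ℝ] V →ₗ[ℝ] ℝ) (hG : ∀ v, G v v = 0 → v = 0) {u v : V}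
    (h : ∀ z, G u z = G v z) : u = v :=
  sub_eq_zero.1 (hG _ (by rw [map_sub G, LinearMap.sub_apply, h, sub_self]))

theorem exists_continuousOn_of_definite {V : Type*} [NormedAddCommGroup V] [NormedSpace ℝ V]
    [FiniteDimensional ℝ V] (G : V →ₗ[ℝ] V →ₗ[ℝ] ℝ) (hG : ∀ v, G v v = 0 → v = 0)
    {S : Set ℝ} (L : ℝ → V →ₗ[ℝ] ℝ) (hL : ∀ v, ContinuousOn (fun t => L t v) S) :
    ∃ b : ℝ → V, ContinuousOn b S ∧ ∀ t v, G (b t) v = L t v := by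
  obtain ⟨Q, hQ⟩ := exists_linearMap_of_definite G hG (LinearMap.id : (V →ₗ[ℝ] ℝ) →ₗ[ℝ] _)
  let B := Module.finBasis ℝ V
  -- The representatives of the coordinate functionals are fixed vectors; time enters only through
  -- the scalars `L t (B i)`, so pointwise continuity of `L` suffices.
  refine ⟨fun t => ∑ i, L t (B i) • Q (B.coord i), ?_, fun t v => ?_⟩
  · exact continuousOn_finsetSum _ fun i _ => (hL (B i)).smul continuousOn_const
  · conv_rhs => rw [← B.sum_repr v]
    simp only [map_sum, map_smul, LinearMap.sum_apply, LinearMap.smul_apply, hQ, LinearMap.id_apply,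
      smul_eq_mul, Module.Basis.coord_apply]
    exact Finset.sum_congr rfl fun i _ => mul_comm _ _

end PoroHDG

/-! ### Hausdorff measure and convex geometry of cells -/

namespace PoroHDG

variable {d m : ℕ}

/-- After translation by `p`, the set `D` is the isometric image of a compact convex subset `G` of
its own direction space, where `G` has nonempty interior. Compactness gives finiteness. Each point
of `G` is a limit of interior points, so a neighbourhood of it contains a nonempty open piece of
`G`, of positive measure. -/
theorem euclideanHausdorffMeasure_convex {D : Set (Pt d)} (hc : IsCompact D) (hconv : Convex ℝ D)
    {p : Pt d} (hp : p ∈ D) :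
    μHE[Module.finrank ℝ (vectorSpan ℝ D)] D < ∞ ∧
      ∀ x ∈ D, ∀ U : Set (Pt d), IsOpen U → x ∈ U →
        0 < μHE[Module.finrank ℝ (vectorSpan ℝ D)] (D ∩ U) := by
  set V := vectorSpan ℝ D with hV
  let φ : V → Pt d := fun v => (v : Pt d) + p
  have hφ : Isometry φ := by
    intro v w
    simp [φ, Subtype.edist_eq]
  set G : Set V := φ ⁻¹' D with hG
  have hGD : φ '' G = D := by
    refine subset_antisymm (image_preimage_subset _ _) fun x hx => ?_
    refine ⟨⟨x - p, vsub_mem_vectorSpan ℝ hx hp⟩, ?_, ?_⟩ <;> simp [hG, φ, hx]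
  have hGc : IsCompact G := hφ.isClosedEmbedding.isCompact_preimage hc
  have hGconv : Convex ℝ G := by
    have := (hconv.translate_preimage_left p).linear_preimage V.subtype
    exact this
  have hGint : (interior G).Nonempty := by
    rw [hGconv.interior_nonempty_iff_affineSpan_eq_top]
    have h0 : (0 : V) ∈ G := by simp [hG, φ, hp]
    rw [AffineSubspace.affineSpan_eq_top_iff_vectorSpan_eq_top_of_nonempty _ _ _ ⟨0, h0⟩]
    -- The differences of points of `G` are, as vectors of the ambient space, the differences of
    -- points of `D`, so they span all of `V`.
    have h1 : (vectorSpan ℝ G).map V.subtype = V := by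
      refine Eq.trans ?_ (vectorSpan_eq_span_vsub_set_right ℝ hp).symm
      rw [vectorSpan_eq_span_vsub_set_right ℝ h0, Submodule.map_span, ← hGD, image_image,
        image_image]
      simp [φ]
    refine Submodule.map_injective_of_injective V.injective_subtype ?_
    rw [h1, Submodule.map_subtype_top]
  constructor
  · rw [← hGD, hφ.euclideanHausdorffMeasure_image]
    exact hGc.measure_lt_top
  · intro x hx U hU hxU
    obtain ⟨v, hv, rfl⟩ := hGD.symm.subset hx
    have h2 : φ '' (G ∩ φ ⁻¹' U) = D ∩ U := by rw [image_inter_preimage, hGD]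
    rw [← h2, hφ.euclideanHausdorffMeasure_image]
    have hUo : IsOpen (φ ⁻¹' U) := hU.preimage hφ.continuous
    have h3 : v ∈ closure (interior G) := by
      rw [hGconv.closure_interior_eq_closure_of_nonempty_interior hGint]
      exact subset_closure hv
    have h4 : (φ ⁻¹' U ∩ interior G).Nonempty := mem_closure_iff.1 h3 _ hUo hxU
    refine (IsOpen.measure_pos _ (hUo.inter isOpen_interior) h4).trans_le (measure_mono ?_)
    exact fun y hy => ⟨interior_subset hy.2, hy.1⟩

theorem vectorSpan_convexHull (s : Set (Pt d)) :
    vectorSpan ℝ (convexHull ℝ s) = vectorSpan ℝ s := by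
  rw [← direction_affineSpan, affineSpan_convexHull, direction_affineSpan]

theorem vectorSpan_translate_parallelepiped {ι : Type*} [Fintype ι] (a : Pt d) (e : ι → Pt d) :
    vectorSpan ℝ ((fun x => a + x) '' parallelepiped e) = Submodule.span ℝ (range e) := by
  classical
  have ha : a ∈ (fun x => a + x) '' parallelepiped e :=
    ⟨0, ⟨0, by simp, by simp⟩, by simp⟩
  apply le_antisymm
  · rw [vectorSpan_eq_span_vsub_set_right ℝ ha, Submodule.span_le]
    rintro _ ⟨_, ⟨_, ⟨t, -, rfl⟩, rfl⟩, rfl⟩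
    simp only [vsub_eq_sub, add_sub_cancel_left, SetLike.mem_coe]
    exact Submodule.sum_mem _ fun i _ =>
      Submodule.smul_mem _ _ (Submodule.subset_span (mem_range_self i))
  · rw [Submodule.span_le]
    rintro _ ⟨i, rfl⟩
    have hi : a + e i ∈ (fun x => a + x) '' parallelepiped e := by
      refine ⟨e i, ⟨Pi.single i 1, ⟨?_, ?_⟩, ?_⟩, rfl⟩
      · simp
      · intro j
        by_cases h : j = i
        · subst h; simp
        · simp [h]
      · simp [Pi.single_apply]
    have := vsub_mem_vectorSpan ℝ hi ha
    simpa using this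

theorem IsCell.convex {D : Set (Pt d)} (h : IsCell m D) : Convex ℝ D := by
  rcases h with ⟨p, -, rfl⟩ | ⟨-, p, -, -, rfl⟩ | ⟨-, a, e, -, rfl⟩
  · exact convex_convexHull ℝ _
  · exact convex_convexHull ℝ _
  · rw [parallelepiped_eq_convexHull]
    exact (convex_convexHull ℝ _).translate a

theorem IsCell.nonempty {D : Set (Pt d)} (h : IsCell m D) : D.Nonempty := by
  rcases h with ⟨p, -, rfl⟩ | ⟨-, p, -, -, rfl⟩ | ⟨-, a, e, -, rfl⟩
  · exact (range_nonempty p).convexHull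
  · exact (range_nonempty p).convexHull
  · exact ⟨a, 0, ⟨0, by simp, by simp⟩, by simp⟩

theorem IsCell.finrank_vectorSpan {D : Set (Pt d)} (h : IsCell m D) :
    Module.finrank ℝ (vectorSpan ℝ D) = m := by
  rcases h with ⟨p, hp, rfl⟩ | ⟨rfl, p, -, hp, rfl⟩ | ⟨rfl, a, e, he, rfl⟩
  · rw [vectorSpan_convexHull]
    exact hp.finrank_vectorSpan (by simp)
  · rw [vectorSpan_convexHull, hp]
  · rw [vectorSpan_translate_parallelepiped]
    simpa using finrank_span_eq_card he

theorem IsCell.measure_lt_top {D : Set (Pt d)} (h : IsCell m D) : μHE[m] D < ∞ := by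
  obtain ⟨p, hp⟩ := h.nonempty
  have := (euclideanHausdorffMeasure_convex h.isCompact h.convex hp).1
  rwa [h.finrank_vectorSpan] at this

theorem IsCell.measure_inter_pos {D : Set (Pt d)} (h : IsCell m D) {x : Pt d} (hx : x ∈ D)
    {U : Set (Pt d)} (hU : IsOpen U) (hxU : x ∈ U) : 0 < μHE[m] (D ∩ U) := by
  have := (euclideanHausdorffMeasure_convex h.isCompact h.convex hx).2 x hx U hU hxU
  rwa [h.finrank_vectorSpan] at this

/-- A convex cell of full dimension has interior points. Hence `fderivWithin` on an element is
unambiguous up to its boundary, which the linearity of `pderivOn` relies on. -/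
theorem IsCell.uniqueDiffOn {D : Set (Pt d)} (h : IsCell d D) : UniqueDiffOn ℝ D := by
  refine uniqueDiffOn_convex h.convex ?_
  rw [h.convex.interior_nonempty_iff_affineSpan_eq_top,
    AffineSubspace.affineSpan_eq_top_iff_vectorSpan_eq_top_of_nonempty _ _ _ h.nonempty]
  apply Submodule.eq_top_of_finrank_eq
  rw [h.finrank_vectorSpan]
  simp

/-- A set of diameter zero is a single point, whose direction space has dimension zero. This allows
division by `h_F`. -/
theorem IsCell.diam_pos {D : Set (Pt d)} (h : IsCell m D) (hm : 0 < m) : 0 < Metric.diam D := by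
  refine Metric.diam_nonneg.lt_of_ne fun h0 => ?_
  have hs : D.Subsingleton := by
    intro x hx y hy
    have := Metric.dist_le_diam_of_mem h.isCompact.isBounded hx hy
    rw [← h0] at this
    exact dist_le_zero.1 this
  have := h.finrank_vectorSpan
  rw [(vectorSpan_eq_bot_iff_subsingleton (k := ℝ) (s := D)).2 hs, finrank_bot] at this
  omega

end PoroHDG

/-! ### Closure properties of linear and bilinear maps -/

theorem IsBilinearMap.add' {V W : Type*} [AddCommGroup V] [Module ℝ V] [AddCommGroup W]
    [Module ℝ W] {f g : V → W → ℝ} (hf : IsBilinearMap ℝ f) (hg : IsBilinearMap ℝ g) :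
    IsBilinearMap ℝ fun v w => f v w + g v w where
  add_left _ _ _ := by rw [hf.add_left, hg.add_left]; ring
  smul_left _ _ _ := by rw [hf.smul_left, hg.smul_left, smul_add]
  add_right _ _ _ := by rw [hf.add_right, hg.add_right]; ring
  smul_right _ _ _ := by rw [hf.smul_right, hg.smul_right, smul_add]

theorem IsBilinearMap.const_mul {V W : Type*} [AddCommGroup V] [Module ℝ V] [AddCommGroup W]
    [Module ℝ W] {f : V → W → ℝ} (hf : IsBilinearMap ℝ f) (r : ℝ) :
    IsBilinearMap ℝ fun v w => r * f v w where
  add_left _ _ _ := by rw [hf.add_left, mul_add]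
  smul_left _ _ _ := by rw [hf.smul_left, smul_eq_mul, smul_eq_mul]; ring
  add_right _ _ _ := by rw [hf.add_right, mul_add]
  smul_right _ _ _ := by rw [hf.smul_right, smul_eq_mul, smul_eq_mul]; ring

theorem IsBilinearMap.sub' {V W : Type*} [AddCommGroup V] [Module ℝ V] [AddCommGroup W]
    [Module ℝ W] {f g : V → W → ℝ} (hf : IsBilinearMap ℝ f) (hg : IsBilinearMap ℝ g) :
    IsBilinearMap ℝ fun v w => f v w - g v w := by
  simpa [sub_eq_add_neg] using hf.add' (hg.const_mul (-1))

theorem IsBilinearMap.finset_sum {V W ι : Type*} [AddCommGroup V] [Module ℝ V] [AddCommGroup W]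
    [Module ℝ W] {f : ι → V → W → ℝ} {s : Finset ι} (hf : ∀ i ∈ s, IsBilinearMap ℝ (f i)) :
    IsBilinearMap ℝ fun v w => ∑ i ∈ s, f i v w where
  add_left _ _ _ := by
    rw [← Finset.sum_add_distrib]; exact Finset.sum_congr rfl fun i hi => (hf i hi).add_left _ _ _
  smul_left _ _ _ := by
    rw [Finset.smul_sum]; exact Finset.sum_congr rfl fun i hi => (hf i hi).smul_left _ _ _
  add_right _ _ _ := by
    rw [← Finset.sum_add_distrib]; exact Finset.sum_congr rfl fun i hi => (hf i hi).add_right _ _ _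
  smul_right _ _ _ := by
    rw [Finset.smul_sum]; exact Finset.sum_congr rfl fun i hi => (hf i hi).smul_right _ _ _

theorem IsLinearMap.isBilinearMap_mul {V W : Type*} [AddCommGroup V] [Module ℝ V] [AddCommGroup W]
    [Module ℝ W] {f : V → ℝ} {g : W → ℝ} (hf : IsLinearMap ℝ f) (hg : IsLinearMap ℝ g) :
    IsBilinearMap ℝ fun v w => f v * g w where
  add_left _ _ _ := by rw [hf.map_add, add_mul]
  smul_left _ _ _ := by rw [hf.map_smul, smul_eq_mul, smul_eq_mul, mul_assoc]
  add_right _ _ _ := by rw [hg.map_add, mul_add]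
  smul_right _ _ _ := by rw [hg.map_smul, smul_eq_mul, smul_eq_mul, mul_left_comm]

theorem IsLinearMap.add' {V : Type*} [AddCommGroup V] [Module ℝ V] {f g : V → ℝ}
    (hf : IsLinearMap ℝ f) (hg : IsLinearMap ℝ g) : IsLinearMap ℝ fun v => f v + g v :=
  (hf.mk' f + hg.mk' g).isLinear

theorem IsLinearMap.sub' {V : Type*} [AddCommGroup V] [Module ℝ V] {f g : V → ℝ}
    (hf : IsLinearMap ℝ f) (hg : IsLinearMap ℝ g) : IsLinearMap ℝ fun v => f v - g v :=
  (hf.mk' f - hg.mk' g).isLinear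

theorem IsLinearMap.neg' {V : Type*} [AddCommGroup V] [Module ℝ V] {f : V → ℝ}
    (hf : IsLinearMap ℝ f) : IsLinearMap ℝ fun v => - f v :=
  (-hf.mk' f).isLinear

theorem IsLinearMap.const_mul {V : Type*} [AddCommGroup V] [Module ℝ V] {f : V → ℝ}
    (hf : IsLinearMap ℝ f) (r : ℝ) : IsLinearMap ℝ fun v => r * f v :=
  (r • hf.mk' f).isLinear

theorem IsLinearMap.mul_const {V : Type*} [AddCommGroup V] [Module ℝ V] {f : V → ℝ}
    (hf : IsLinearMap ℝ f) (r : ℝ) : IsLinearMap ℝ fun v => f v * r := by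
  simpa only [mul_comm] using hf.const_mul r

theorem IsLinearMap.div_const {V : Type*} [AddCommGroup V] [Module ℝ V] {f : V → ℝ}
    (hf : IsLinearMap ℝ f) (r : ℝ) : IsLinearMap ℝ fun v => f v / r := by
  simpa only [div_eq_mul_inv] using hf.mul_const r⁻¹

theorem IsLinearMap.finset_sum {V ι : Type*} [AddCommGroup V] [Module ℝ V] {f : ι → V → ℝ}
    {s : Finset ι} (hf : ∀ i ∈ s, IsLinearMap ℝ (f i)) : IsLinearMap ℝ fun v => ∑ i ∈ s, f i v where
  map_add _ _ := by
    rw [← Finset.sum_add_distrib]; exact Finset.sum_congr rfl fun i hi => (hf i hi).map_add _ _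
  map_smul _ _ := by
    rw [Finset.smul_sum]; exact Finset.sum_congr rfl fun i hi => (hf i hi).map_smul _ _

/-- Bilinearity of the integrand is required only on `D`, since derivatives on an element depend
linearly on the function only at points of that element. -/
theorem IsBilinearMap.setIntegral {V W X : Type*} [AddCommGroup V] [Module ℝ V] [AddCommGroup W]
    [Module ℝ W] [MeasurableSpace X] {μ : Measure X} {D : Set X} (hD : MeasurableSet D)
    {φ : X → V → W → ℝ} (hφ : ∀ x ∈ D, IsBilinearMap ℝ (φ x))
    (hi : ∀ v w, IntegrableOn (fun x => φ x v w) D μ) :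
    IsBilinearMap ℝ fun v w => ∫ x in D, φ x v w ∂μ where
  add_left u v w := by
    rw [← integral_add (hi _ _) (hi _ _)]
    exact setIntegral_congr_fun hD fun x hx => (hφ x hx).add_left u v w
  smul_left r v w := by
    rw [← integral_smul]
    exact setIntegral_congr_fun hD fun x hx => (hφ x hx).smul_left r v w
  add_right u v w := by
    rw [← integral_add (hi _ _) (hi _ _)]
    exact setIntegral_congr_fun hD fun x hx => (hφ x hx).add_right u v w
  smul_right r v w := by
    rw [← integral_smul]
    exact setIntegral_congr_fun hD fun x hx => (hφ x hx).smul_right r v w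

/-! ### Integration and polynomials on a cell -/

namespace PoroHDG

variable {d m : ℕ} {D : Set (Pt d)}

theorem IsCell.integrableOn (hD : IsCell m D) {f : Pt d → ℝ} (hf : ContinuousOn f D) :
    IntegrableOn f D μHE[m] :=
  hf.integrableOn_of_subset_isCompact hD.isCompact hD.isCompact.measurableSet Subset.rfl
    hD.measure_lt_top.ne

theorem IsCell.integrableOn_volume (hD : IsCell d D) {f : Pt d → ℝ} (hf : ContinuousOn f D) :
    IntegrableOn f D := by
  rw [← EuclideanSpace.euclideanHausdorffMeasure_eq_volume]
  exact hD.integrableOn hf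

/-- A zero integral gives vanishing almost everywhere. A nonzero value would persist on a relatively
open part of `D`, which has positive measure by `IsCell.measure_inter_pos`. -/
theorem IsCell.eq_zero_of_setIntegral_eq_zero (hD : IsCell m D) {f : Pt d → ℝ}
    (hf : ContinuousOn f D) (h0 : ∀ x ∈ D, 0 ≤ f x) (hi : ∫ x in D, f x ∂μHE[m] = 0) :
    ∀ x ∈ D, f x = 0 := by
  by_contra! h
  obtain ⟨x, hx, hne⟩ := h
  rw [setIntegral_eq_zero_iff_of_nonneg_ae
    (ae_restrict_of_forall_mem hD.isCompact.measurableSet h0) (hD.integrableOn hf)] at hi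
  obtain ⟨U, hU, hxU, hUD⟩ := mem_nhdsWithin.1
    ((hf x hx).eventually_ne hne)
  have h1 := hD.measure_inter_pos hx hU hxU
  have h2 : μHE[m] (D ∩ U) = 0 := by
    refine measure_mono_null ?_ ((ae_restrict_iff' hD.isCompact.measurableSet).1 hi)
    intro y hy hc
    exact hUD ⟨hy.2, hy.1⟩ (hc hy.1)
  exact h1.ne' h2

theorem IsCell.eq_zero_of_setIntegral_volume_eq_zero (hD : IsCell d D) {f : Pt d → ℝ}
    (hf : ContinuousOn f D) (h0 : ∀ x ∈ D, 0 ≤ f x) (hi : ∫ x in D, f x = 0) :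
    ∀ x ∈ D, f x = 0 := by
  rw [← EuclideanSpace.euclideanHausdorffMeasure_eq_volume] at hi
  exact hD.eq_zero_of_setIntegral_eq_zero hf h0 hi

theorem ev_of_mem (f : C(D, ℝ)) {x : Pt d} (hx : x ∈ D) : ev f x = f ⟨x, hx⟩ := dif_pos hx

theorem ev_of_notMem (f : C(D, ℝ)) {x : Pt d} (hx : x ∉ D) : ev f x = 0 := dif_neg hx

theorem ev_add (f g : C(D, ℝ)) (x : Pt d) : ev (f + g) x = ev f x + ev g x := by
  by_cases hx : x ∈ D <;> simp [ev, hx]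

theorem ev_smul (r : ℝ) (f : C(D, ℝ)) (x : Pt d) : ev (r • f) x = r * ev f x := by
  by_cases hx : x ∈ D <;> simp [ev, hx]

@[simp] theorem ev_zero (x : Pt d) : ev (0 : C(D, ℝ)) x = 0 := by
  by_cases hx : x ∈ D <;> simp [ev, hx]

theorem eq_zero_of_ev {f : C(D, ℝ)} (h : ∀ x ∈ D, ev f x = 0) : f = 0 := by
  ext x
  have := h x.1 x.2
  rwa [ev_of_mem f x.2] at this

theorem continuousOn_ev (f : C(D, ℝ)) : ContinuousOn (ev f) D := by
  rw [continuousOn_iff_continuous_domRestrict]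
  convert f.continuous using 1
  ext x
  exact ev_of_mem f x.2

theorem finiteDimensional_restrictDegree (n ℓ : ℕ) :
    FiniteDimensional ℝ (MvPolynomial.restrictDegree (Fin n) ℝ ℓ) := by
  have : Finite {s : Fin n →₀ ℕ | ∀ i, s i ≤ ℓ} := by
    refine Set.Finite.to_subtype ?_
    refine ((Set.finite_Iic (Finsupp.equivFunOnFinite.symm fun _ : Fin n => ℓ)).subset ?_)
    intro s hs i
    exact hs i
  exact Module.Finite.of_basis (MvPolynomial.basisRestrictSupport ℝ _)

instance finiteDimensional_polySpace (ℓ : ℕ) (c : Fin m → (Pt d →L[ℝ] ℝ)) :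
    FiniteDimensional ℝ (polySpace ℓ D c) := by
  have h := finiteDimensional_restrictDegree m ℓ
  have h' : FiniteDimensional ℝ (MvPolynomial.restrictTotalDegree (Fin m) ℝ ℓ) :=
    Submodule.finiteDimensional_of_le
      (MvPolynomial.restrictTotalDegree_le_restrictDegree (Fin m) ℝ ℓ)
  by_cases hD : IsSimplexCell m D
  · have e : polySpace ℓ D c =
        (MvPolynomial.restrictTotalDegree (Fin m) ℝ ℓ).map (polyEval D c) := if_pos hD
    rw [e]
    infer_instance
  · have e : polySpace ℓ D c =
        (MvPolynomial.restrictDegree (Fin m) ℝ ℓ).map (polyEval D c) := if_neg hD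
    rw [e]
    infer_instance

/-- The zero extension `ev f` jumps at the boundary of `D`; this smooth global representative is
what makes it differentiable within `D`. -/
theorem exists_contDiff_of_mem_polySpace {ℓ : ℕ} {c : Fin m → (Pt d →L[ℝ] ℝ)} {f : C(D, ℝ)}
    (hf : f ∈ polySpace ℓ D c) : ∃ p : Pt d → ℝ, ContDiff ℝ 1 p ∧ EqOn (ev f) p D := by
  have h : ∃ q, polyEval D c q = f := by
    unfold polySpace at hf
    split_ifs at hf <;> exact (Submodule.mem_map.1 hf).imp fun _ h => h.2
  obtain ⟨q, rfl⟩ := h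
  refine ⟨fun x => MvPolynomial.eval (fun i => c i x) q, ?_, fun x hx => ev_of_mem _ hx⟩
  simp only [MvPolynomial.eval_eq]
  fun_prop

theorem differentiableWithinAt_ev {ℓ : ℕ} {c : Fin m → (Pt d →L[ℝ] ℝ)} {f : C(D, ℝ)}
    (hf : f ∈ polySpace ℓ D c) {x : Pt d} (hx : x ∈ D) : DifferentiableWithinAt ℝ (ev f) D x := by
  obtain ⟨p, hp, he⟩ := exists_contDiff_of_mem_polySpace hf
  exact ((hp.differentiable one_ne_zero x).differentiableWithinAt).congr he (he hx)

theorem IsCell.continuousOn_pderivOn (hD : IsCell d D) {ℓ : ℕ} {c : Fin m → (Pt d →L[ℝ] ℝ)}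
    {f : C(D, ℝ)} (hf : f ∈ polySpace ℓ D c) (j : Fin d) : ContinuousOn (pderivOn f j) D := by
  obtain ⟨p, hp, he⟩ := exists_contDiff_of_mem_polySpace hf
  have h : ContinuousOn (fun x => fderiv ℝ p x (EuclideanSpace.single j 1)) D :=
    ((hp.continuous_fderiv one_ne_zero).clm_apply continuous_const).continuousOn
  refine h.congr fun x hx => ?_
  rw [pderivOn, fderivWithin_congr he (he hx),
    (hp.differentiable one_ne_zero x).fderivWithin (hD.uniqueDiffOn x hx)]

theorem IsCell.pderivOn_add (hD : IsCell d D) {ℓ : ℕ} {c : Fin m → (Pt d →L[ℝ] ℝ)}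
    {f g : C(D, ℝ)} (hf : f ∈ polySpace ℓ D c) (hg : g ∈ polySpace ℓ D c) (j : Fin d) {x : Pt d}
    (hx : x ∈ D) : pderivOn (f + g) j x = pderivOn f j x + pderivOn g j x := by
  have h : ev (f + g) = ev f + ev g := funext (ev_add f g)
  rw [pderivOn, h, fderivWithin_add (hD.uniqueDiffOn x hx) (differentiableWithinAt_ev hf hx)
    (differentiableWithinAt_ev hg hx)]
  rfl

theorem IsCell.pderivOn_smul (hD : IsCell d D) {ℓ : ℕ} {c : Fin m → (Pt d →L[ℝ] ℝ)}
    {f : C(D, ℝ)} (hf : f ∈ polySpace ℓ D c) (r : ℝ) (j : Fin d) {x : Pt d}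
    (hx : x ∈ D) : pderivOn (r • f) j x = r * pderivOn f j x := by
  have h : ev (r • f) = r • ev f := funext (ev_smul r f)
  rw [pderivOn, h, fderivWithin_const_smul (hD.uniqueDiffOn x hx) (differentiableWithinAt_ev hf hx)]
  rfl

/-! ### Mesh incidences and finite dimension of the discrete spaces -/

namespace Mesh

variable {d : ℕ} {Ω : Set (Pt d)} {M : Mesh Ω} {k : ℕ}

theorem isCell_elem (K : M.Elem) : IsCell d (K : Set (Pt d)) := M.isCell_of_mem_elems K.1 K.2

theorem isCell_face (F : M.Face) : IsCell (d - 1) (F : Set (Pt d)) := M.isCell_of_mem_faces F.1 F.2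

theorem measurableSet_elem (K : M.Elem) : MeasurableSet (K : Set (Pt d)) :=
  (isCell_elem K).isCompact.measurableSet

theorem measurableSet_face (F : M.Face) : MeasurableSet (F : Set (Pt d)) :=
  (isCell_face F).isCompact.measurableSet

theorem mem_facesOf {K : M.Elem} {F : M.Face} :
    F ∈ M.facesOf K ↔ (F : Set (Pt d)) ⊆ (K : Set (Pt d)) := by
  simp [facesOf]

theorem mem_elemsOf {K : M.Elem} {F : M.Face} :
    K ∈ M.elemsOf F ↔ (F : Set (Pt d)) ⊆ (K : Set (Pt d)) := by
  simp [elemsOf]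

/-- Ensures that the denominator of `mean` is not zero. -/
theorem elemsOf_nonempty (F : M.Face) : (M.elemsOf F).Nonempty := by
  rcases F.2 with h | h
  · obtain ⟨K, hK, K', -, -, hF, -⟩ := (M.mem_interiorFaces F.1).1 h
    exact ⟨⟨K, hK⟩, mem_elemsOf.2 (hF.subset.trans inter_subset_left)⟩
  · obtain ⟨K, hK, ⟨⟨n, -, hF⟩, -⟩, -⟩ := (M.mem_boundaryFaces F.1).1 h
    exact ⟨⟨K, hK⟩, mem_elemsOf.2 (hF.subset.trans (sep_subset _ _))⟩

instance (ℓ : ℕ) (K : M.Elem) : FiniteDimensional ℝ (M.elemPoly ℓ K) :=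
  finiteDimensional_polySpace ℓ _

instance (ℓ : ℕ) (F : M.Face) : FiniteDimensional ℝ (M.facePoly ℓ F) :=
  finiteDimensional_polySpace ℓ _

instance : FiniteDimensional ℝ (M.velSpace k) := by
  let φ : M.velSpace k →ₗ[ℝ] (Fin 2 → Fin d → ∀ K : M.Elem, M.elemPoly (k + 1) K) :=
    { toFun := fun v a i K => ⟨v.1 a i K, v.2 a i K⟩
      map_add' := fun _ _ => rfl
      map_smul' := fun _ _ => rfl }
  refine FiniteDimensional.of_injective φ fun u v h => ?_
  ext1
  funext a i K
  exact congrArg Subtype.val (congrFun (congrFun (congrFun h a) i) K)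

instance : FiniteDimensional ℝ (M.traceSpace k) := by
  let φ : M.traceSpace k →ₗ[ℝ] (Fin 2 → Fin d → ∀ F : M.Face, M.facePoly (k + 1) F) :=
    { toFun := fun v a i F => ⟨v.1 a i F, v.2.1 a i F⟩
      map_add' := fun _ _ => rfl
      map_smul' := fun _ _ => rfl }
  refine FiniteDimensional.of_injective φ fun u v h => ?_
  ext1
  funext a i F
  exact congrArg Subtype.val (congrFun (congrFun (congrFun h a) i) F)

instance : FiniteDimensional ℝ (M.stressSpace k) := by
  let φ : M.stressSpace k →ₗ[ℝ]
      (Fin d → Fin d → ∀ K : M.Elem, M.elemPoly k K) × (∀ K : M.Elem, M.elemPoly k K) :=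
    { toFun := fun τ => (fun i j K => ⟨τ.1.1 i j K, τ.2.1 i j K⟩, fun K => ⟨τ.1.2 K, τ.2.2.1 K⟩)
      map_add' := fun _ _ => rfl
      map_smul' := fun _ _ => rfl }
  refine FiniteDimensional.of_injective φ fun u v h => ?_
  have h1 := congrArg Prod.fst h
  have h2 := congrArg Prod.snd h
  ext1
  refine Prod.ext ?_ ?_
  · funext i j K
    exact congrArg Subtype.val (congrFun (congrFun (congrFun h1 i) j) K)
  · funext K
    exact congrArg Subtype.val (congrFun h2 K)

/-! ### Linearity and continuity of the integrands -/

theorem continuousOn_ev_face {K : M.Elem} {F : M.Face} (h : (F : Set (Pt d)) ⊆ (K : Set (Pt d)))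
    (f : C((K : Set (Pt d)), ℝ)) : ContinuousOn (ev f) (F : Set (Pt d)) :=
  (continuousOn_ev f).mono h

theorem isLinearMap_vel (a : Fin 2) (i : Fin d) (K : M.Elem) (x : Pt d) :
    IsLinearMap ℝ fun v : M.velSpace k => ev (v.1 a i K) x :=
  ⟨fun _ _ => ev_add _ _ _, fun _ _ => ev_smul _ _ _⟩

theorem isLinearMap_trace (a : Fin 2) (i : Fin d) (F : M.Face) (x : Pt d) :
    IsLinearMap ℝ fun v : M.traceSpace k => ev (v.1 a i F) x :=
  ⟨fun _ _ => ev_add _ _ _, fun _ _ => ev_smul _ _ _⟩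

theorem isLinearMap_stress (i j : Fin d) (K : M.Elem) (x : Pt d) :
    IsLinearMap ℝ fun τ : M.stressSpace k => ev (τ.1.1 i j K) x :=
  ⟨fun _ _ => ev_add _ _ _, fun _ _ => ev_smul _ _ _⟩

theorem isLinearMap_pressure (K : M.Elem) (x : Pt d) :
    IsLinearMap ℝ fun τ : M.stressSpace k => ev (τ.1.2 K) x :=
  ⟨fun _ _ => ev_add _ _ _, fun _ _ => ev_smul _ _ _⟩

theorem isLinearMap_jump (a : Fin 2) (i : Fin d) (K : M.Elem) (F : M.Face) (x : Pt d) :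
    IsLinearMap ℝ fun p : M.velSpace k × M.traceSpace k =>
      ev (p.1.1 a i K) x - ev (p.2.1 a i F) x :=
  IsLinearMap.sub' ⟨fun _ _ => ev_add _ _ _, fun _ _ => ev_smul _ _ _⟩
    ⟨fun _ _ => ev_add _ _ _, fun _ _ => ev_smul _ _ _⟩

theorem isLinearMap_totalStress (c : BiotCoeff d) (K : M.Elem) (i j : Fin d) (x : Pt d) :
    IsLinearMap ℝ fun τ : M.stressSpace k => totalStress c τ K i j x :=
  (isLinearMap_stress i j K x).sub' (((isLinearMap_pressure K x).const_mul _).mul_const _)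

theorem isLinearMap_pderivOn (a : Fin 2) (i j : Fin d) (K : M.Elem) {x : Pt d} (hx : x ∈ K.1) :
    IsLinearMap ℝ fun v : M.velSpace k => pderivOn (v.1 a i K) j x :=
  ⟨fun u v => (isCell_elem K).pderivOn_add (u.2 a i K) (v.2 a i K) j hx,
    fun r v => (isCell_elem K).pderivOn_smul (v.2 a i K) r j hx⟩

theorem isLinearMap_strain (K : M.Elem) (i j : Fin d) {x : Pt d} (hx : x ∈ K.1) :
    IsLinearMap ℝ fun v : M.velSpace k => strain v K i j x :=
  ((isLinearMap_pderivOn 0 i j K hx).add' (isLinearMap_pderivOn 0 j i K hx)).div_const 2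

theorem isLinearMap_divFluid (K : M.Elem) {x : Pt d} (hx : x ∈ K.1) :
    IsLinearMap ℝ fun v : M.velSpace k => divFluid v K x :=
  IsLinearMap.finset_sum fun i _ => isLinearMap_pderivOn 1 i i K hx

theorem continuousOn_pderivOn (v : M.velSpace k) (a : Fin 2) (i j : Fin d) (K : M.Elem) :
    ContinuousOn (pderivOn (v.1 a i K) j) (K : Set (Pt d)) :=
  (isCell_elem K).continuousOn_pderivOn (v.2 a i K) j

theorem continuousOn_strain (v : M.velSpace k) (K : M.Elem) (i j : Fin d) :
    ContinuousOn (strain v K i j) (K : Set (Pt d)) :=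
  ((continuousOn_pderivOn v 0 i j K).add (continuousOn_pderivOn v 0 j i K)).div_const 2

theorem continuousOn_divFluid (v : M.velSpace k) (K : M.Elem) :
    ContinuousOn (divFluid v K) (K : Set (Pt d)) :=
  continuousOn_finsetSum _ fun i _ => continuousOn_pderivOn v 1 i i K

theorem continuousOn_totalStress (c : BiotCoeff d) (τ : M.stressSpace k) (K : M.Elem)
    (i j : Fin d) : ContinuousOn (totalStress c τ K i j) (K : Set (Pt d)) :=
  (continuousOn_ev _).sub ((continuousOn_const.mul (continuousOn_ev _)).mul continuousOn_const)

theorem isBilinearMap_sum_elem {V W : Type*} [AddCommGroup V] [Module ℝ V] [AddCommGroup W]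
    [Module ℝ W] {φ : M.Elem → Pt d → V → W → ℝ} (hφ : ∀ K, ∀ x ∈ K.1, IsBilinearMap ℝ (φ K x))
    (hc : ∀ K v w, ContinuousOn (fun x => φ K x v w) K.1) :
    IsBilinearMap ℝ fun v w => ∑ K : M.Elem, ∫ x in K.1, φ K x v w :=
  IsBilinearMap.finset_sum fun K _ => IsBilinearMap.setIntegral (measurableSet_elem K) (hφ K)
    fun v w => (isCell_elem K).integrableOn_volume (hc K v w)

theorem isBilinearMap_face {V W : Type*} [AddCommGroup V] [Module ℝ V] [AddCommGroup W]
    [Module ℝ W] {F : M.Face} {φ : Pt d → V → W → ℝ} (hφ : ∀ x ∈ F.1, IsBilinearMap ℝ (φ x))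
    (hc : ∀ v w, ContinuousOn (fun x => φ x v w) F.1) :
    IsBilinearMap ℝ fun v w => ∫ x in F.1, φ x v w ∂μHE[d - 1] :=
  IsBilinearMap.setIntegral (measurableSet_face F) hφ
    fun v w => (isCell_face F).integrableOn (hc v w)

theorem continuousOn_innerH1_integrand (c : BiotCoeff d) (u v : M.velSpace k) (K : M.Elem) :
    ContinuousOn (fun x => ∑ i, ∑ b, (∑ a, ev (u.1 a i K) x * c.R a b) * ev (v.1 b i K) x) K.1 := by
  have := fun f : C((K : Set (Pt d)), ℝ) => continuousOn_ev f
  fun_prop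

theorem isBilinearMap_innerH1 (c : BiotCoeff d) :
    IsBilinearMap ℝ fun u v : M.velSpace k => innerH1 c u v := by
  refine isBilinearMap_sum_elem (fun K x _ => ?_) fun K u v => ?_
  · refine IsBilinearMap.finset_sum fun i _ => IsBilinearMap.finset_sum fun b _ =>
      IsLinearMap.isBilinearMap_mul (IsLinearMap.finset_sum fun a _ => ?_) (isLinearMap_vel b i K x)
    exact (isLinearMap_vel a i K x).mul_const _
  · exact continuousOn_innerH1_integrand c u v K

theorem isBilinearMap_damping (c : BiotCoeff d) :
    IsBilinearMap ℝ fun u v : M.velSpace k => damping c u v := by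
  refine isBilinearMap_sum_elem (fun K x _ => ?_) fun K u v => ?_
  · exact (IsBilinearMap.finset_sum fun i _ =>
      IsLinearMap.isBilinearMap_mul (isLinearMap_vel 1 i K x) (isLinearMap_vel 1 i K x)).const_mul _
  · have := fun f : C((K : Set (Pt d)), ℝ) => continuousOn_ev f
    fun_prop

/-- The jump `v - v̂` is linear in the pair, so velocity and trace are bundled into a single
argument. -/
theorem isBilinearMap_stab :
    IsBilinearMap ℝ fun p q : M.velSpace k × M.traceSpace k => stab p.1 p.2 q.1 q.2 := by
  refine IsBilinearMap.finset_sum fun K _ => IsBilinearMap.finset_sum fun F hF =>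
    (isBilinearMap_face (fun x _ => ?_) fun u v => ?_).const_mul _
  · exact IsBilinearMap.finset_sum fun a _ => IsBilinearMap.finset_sum fun i _ =>
      IsLinearMap.isBilinearMap_mul (isLinearMap_jump a i K F x) (isLinearMap_jump a i K F x)
  · have := fun f : C((K : Set (Pt d)), ℝ) => continuousOn_ev_face (mem_facesOf.1 hF) f
    have := fun f : C((F : Set (Pt d)), ℝ) => continuousOn_ev f
    fun_prop

theorem isBilinearMap_Bh (c : BiotCoeff d) :
    IsBilinearMap ℝ fun (τ : M.stressSpace k) (p : M.velSpace k × M.traceSpace k) =>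
      Bh c τ p.1 p.2 := by
  have hfst : ∀ {f : M.velSpace k → ℝ}, IsLinearMap ℝ f →
      IsLinearMap ℝ fun p : M.velSpace k × M.traceSpace k => f p.1 := fun hf =>
    ⟨fun _ _ => hf.map_add _ _, fun _ _ => hf.map_smul _ _⟩
  refine (((isBilinearMap_sum_elem (fun K x hx => ?_) fun K u v => ?_).sub'
    (isBilinearMap_sum_elem (fun K x hx => ?_) fun K u v => ?_)).sub'
    (IsBilinearMap.finset_sum fun K _ => IsBilinearMap.finset_sum fun F hF =>
      isBilinearMap_face (fun x _ => ?_) fun u v => ?_)).add'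
    (IsBilinearMap.finset_sum fun K _ => IsBilinearMap.finset_sum fun F hF =>
      isBilinearMap_face (fun x _ => ?_) fun u v => ?_)
  · exact IsBilinearMap.finset_sum fun i _ => IsBilinearMap.finset_sum fun j _ =>
      IsLinearMap.isBilinearMap_mul (isLinearMap_totalStress c K i j x)
        (hfst (isLinearMap_strain K i j hx))
  · exact continuousOn_finsetSum _ fun i _ => continuousOn_finsetSum _ fun j _ =>
      (continuousOn_totalStress c u K i j).mul (continuousOn_strain v.1 K i j)
  · exact IsLinearMap.isBilinearMap_mul (isLinearMap_pressure K x)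
      (hfst (isLinearMap_divFluid K hx))
  · exact (continuousOn_ev _).mul (continuousOn_divFluid v.1 K)
  · exact IsBilinearMap.finset_sum fun i _ => IsLinearMap.isBilinearMap_mul
      (IsLinearMap.finset_sum fun j _ => (isLinearMap_totalStress c K i j x).mul_const _)
      (isLinearMap_jump 0 i K F x)
  · have := fun f : C((K : Set (Pt d)), ℝ) => continuousOn_ev_face (mem_facesOf.1 hF) f
    have := fun f : C((F : Set (Pt d)), ℝ) => continuousOn_ev f
    have := fun i j => (continuousOn_totalStress c u K i j).mono (mem_facesOf.1 hF)
    fun_prop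
  · exact IsBilinearMap.finset_sum fun i _ => IsLinearMap.isBilinearMap_mul
      ((isLinearMap_pressure K x).mul_const _) (isLinearMap_jump 1 i K F x)
  · have := fun f : C((K : Set (Pt d)), ℝ) => continuousOn_ev_face (mem_facesOf.1 hF) f
    have := fun f : C((F : Set (Pt d)), ℝ) => continuousOn_ev f
    fun_prop

theorem stressAt_add (σ τ : M.stressSpace k) (K : M.Elem) (x : Pt d) :
    stressAt (σ + τ) K x = stressAt σ K x + stressAt τ K x := by
  ext i j
  exact ev_add _ _ _

theorem stressAt_smul (r : ℝ) (τ : M.stressSpace k) (K : M.Elem) (x : Pt d) :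
    stressAt (r • τ) K x = r • stressAt τ K x := by
  ext i j
  exact ev_smul _ _ _

theorem continuousOn_stressAt (τ : M.stressSpace k) (K : M.Elem) :
    ContinuousOn (stressAt τ K) (K : Set (Pt d)) := by
  refine continuousOn_iff_continuous_domRestrict.2 (Continuous.subtype_mk ?_ _)
  refine continuous_pi fun i => continuous_pi fun j => ?_
  exact continuousOn_iff_continuous_domRestrict.1 (continuousOn_ev (τ.1.1 i j K))

theorem continuousOn_innerH2_integrand (c : BiotCoeff d) (σ τ : M.stressSpace k) (K : M.Elem) :
    ContinuousOn (fun x => frob (c.compliance (stressAt σ K x)) (stressAt τ K x)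
      + c.s * ev (σ.1.2 K) x * ev (τ.1.2 K) x) K.1 := by
  have := fun f : C((K : Set (Pt d)), ℝ) => continuousOn_ev f
  have h1 : Continuous c.compliance :=
    LinearMap.continuous_of_finiteDimensional c.compliance.toLinearMap
  have h2 : ∀ i j, ContinuousOn (fun x => (c.compliance (stressAt σ K x)).1 i j) K.1 := by
    intro i j
    have h3 : Continuous fun A : symMat d => A.1 i j :=
      (continuous_apply_apply i j).comp continuous_subtype_val
    exact h3.comp_continuousOn (h1.comp_continuousOn (continuousOn_stressAt σ K))
  refine ContinuousOn.add ?_ (by fun_prop)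
  exact continuousOn_finsetSum _ fun i _ => continuousOn_finsetSum _ fun j _ =>
    (h2 i j).mul (continuousOn_ev _)

theorem isBilinearMap_innerH2 (c : BiotCoeff d) :
    IsBilinearMap ℝ fun σ τ : M.stressSpace k => innerH2 c σ τ := by
  refine isBilinearMap_sum_elem (fun K x _ => ?_) fun K u v => ?_
  · refine IsBilinearMap.add' ?_ (IsLinearMap.isBilinearMap_mul
      ((isLinearMap_pressure K x).const_mul _) (isLinearMap_pressure K x))
    refine IsBilinearMap.finset_sum fun i _ => IsBilinearMap.finset_sum fun j _ =>
      IsLinearMap.isBilinearMap_mul ⟨fun σ τ => ?_, fun r τ => ?_⟩ (isLinearMap_stress i j K x)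
    · rw [stressAt_add, map_add]; rfl
    · rw [stressAt_smul, map_smul]; rfl
  · exact continuousOn_innerH2_integrand c u v K

end Mesh

/-! ### Positivity of the material coefficients -/

namespace BiotCoeff

variable {d : ℕ} (c : BiotCoeff d)

/-- With `A = C B` the value is `C B : B` by symmetry of `C`. -/
theorem frob_compliance_pos {A : symMat d} (hA : A ≠ 0) : 0 < frob (c.compliance A) A := by
  have h1 : c.C (c.compliance A) = A :=
    (LinearEquiv.ofInjectiveEndo c.C c.C_injective).apply_symm_apply A
  have h2 : c.compliance A ≠ 0 := by simpa using hA
  have h3 := c.C_pos _ h2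
  rw [c.C_symm, h1] at h3
  exact h3

theorem frob_compliance_nonneg (A : symMat d) : 0 ≤ frob (c.compliance A) A := by
  by_cases hA : A = 0
  · subst hA; simp [frob]
  · exact (c.frob_compliance_pos hA).le

/-- Completing the square. The three coefficients are positive because `0 < φ < 1` and `1 < ν`,
which is where these bounds on porosity and tortuosity enter. -/
theorem sum_R_eq (u : Fin 2 → ℝ) :
    ∑ b, (∑ a, u a * c.R a b) * u b =
      ((1 - c.φ) * c.ρs) * u 0 ^ 2 + c.ρf * (c.φ * u 0 + u 1) ^ 2 / c.φ
        + (c.ν - 1) / c.φ * c.ρf * u 1 ^ 2 := by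
  have := c.φ_pos.ne'
  simp only [Fin.sum_univ_two, R, Matrix.of_apply, Matrix.cons_val', Matrix.cons_val_zero,
    Matrix.cons_val_one, Matrix.cons_val_fin_one]
  field_simp
  ring

theorem sum_R_nonneg (u : Fin 2 → ℝ) : 0 ≤ ∑ b, (∑ a, u a * c.R a b) * u b := by
  rw [sum_R_eq]
  have h1 : 0 < (1 - c.φ) * c.ρs := mul_pos (sub_pos.2 c.φ_lt_one) c.ρs_pos
  have h2 : 0 < (c.ν - 1) / c.φ * c.ρf :=
    mul_pos (div_pos (sub_pos.2 c.one_lt_ν) c.φ_pos) c.ρf_pos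
  have h3 := c.ρf_pos
  have h4 := c.φ_pos
  positivity

theorem eq_zero_of_sum_R_eq_zero {u : Fin 2 → ℝ} (h : ∑ b, (∑ a, u a * c.R a b) * u b = 0)
    (a : Fin 2) : u a = 0 := by
  rw [sum_R_eq] at h
  have h1 : 0 < (1 - c.φ) * c.ρs := mul_pos (sub_pos.2 c.φ_lt_one) c.ρs_pos
  have h2 : 0 < (c.ν - 1) / c.φ * c.ρf :=
    mul_pos (div_pos (sub_pos.2 c.one_lt_ν) c.φ_pos) c.ρf_pos
  have h3 := c.ρf_pos
  have h4 := c.φ_pos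
  have h5 : 0 ≤ ((1 - c.φ) * c.ρs) * u 0 ^ 2 := by positivity
  have h6 : 0 ≤ c.ρf * (c.φ * u 0 + u 1) ^ 2 / c.φ := by positivity
  have h7 : 0 ≤ (c.ν - 1) / c.φ * c.ρf * u 1 ^ 2 := by positivity
  have h8 : ((1 - c.φ) * c.ρs) * u 0 ^ 2 = 0 := by linarith
  have h9 : (c.ν - 1) / c.φ * c.ρf * u 1 ^ 2 = 0 := by linarith
  fin_cases a
  · simpa [h1.ne'] using h8
  · exact pow_eq_zero_iff two_ne_zero |>.1 ((mul_eq_zero.1 h9).resolve_left h2.ne')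

end BiotCoeff

/-! ### Definite forms on the discrete spaces and the trace projection -/

namespace Mesh

variable {d : ℕ} {Ω : Set (Pt d)} {M : Mesh Ω} {k : ℕ} (c : BiotCoeff d)

theorem innerH1_integrand_nonneg (u : M.velSpace k) (K : M.Elem) (x : Pt d) :
    0 ≤ ∑ i, ∑ b, (∑ a, ev (u.1 a i K) x * c.R a b) * ev (u.1 b i K) x :=
  Finset.sum_nonneg fun i _ => c.sum_R_nonneg fun a => ev (u.1 a i K) x

theorem innerH2_integrand_nonneg (τ : M.stressSpace k) (K : M.Elem) (x : Pt d) :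
    0 ≤ frob (c.compliance (stressAt τ K x)) (stressAt τ K x)
      + c.s * ev (τ.1.2 K) x * ev (τ.1.2 K) x := by
  have h1 := c.frob_compliance_nonneg (stressAt τ K x)
  have h2 := mul_nonneg c.s_pos.le (mul_self_nonneg (ev (τ.1.2 K) x))
  linarith

theorem innerH1_self_nonneg (u : M.velSpace k) : 0 ≤ innerH1 c u u :=
  Finset.sum_nonneg fun K _ => integral_nonneg fun x => innerH1_integrand_nonneg c u K x

theorem innerH2_self_nonneg (τ : M.stressSpace k) : 0 ≤ innerH2 c τ τ :=
  Finset.sum_nonneg fun K _ => integral_nonneg fun x => innerH2_integrand_nonneg c τ K x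

theorem eq_zero_of_innerH1_self {u : M.velSpace k} (h : innerH1 c u u = 0) : u = 0 := by
  ext1
  funext a i K
  refine eq_zero_of_ev fun x hx => ?_
  have h1 := (Finset.sum_eq_zero_iff_of_nonneg fun K _ =>
    integral_nonneg fun x => innerH1_integrand_nonneg c u K x).1 h K (Finset.mem_univ K)
  have h2 := (isCell_elem K).eq_zero_of_setIntegral_volume_eq_zero
    (continuousOn_innerH1_integrand c u u K) (fun x _ => innerH1_integrand_nonneg c u K x) h1 x hx
  have h3 := (Finset.sum_eq_zero_iff_of_nonneg fun i _ =>
    c.sum_R_nonneg fun a => ev (u.1 a i K) x).1 h2 i (Finset.mem_univ i)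
  exact c.eq_zero_of_sum_R_eq_zero h3 a

theorem eq_zero_of_innerH2_self {τ : M.stressSpace k} (h : innerH2 c τ τ = 0) : τ = 0 := by
  have key : ∀ (K : M.Elem), ∀ x ∈ K.1, stressAt τ K x = 0 ∧ ev (τ.1.2 K) x = 0 := by
    intro K x hx
    have h1 := (Finset.sum_eq_zero_iff_of_nonneg fun K _ =>
      integral_nonneg fun x => innerH2_integrand_nonneg c τ K x).1 h K (Finset.mem_univ K)
    have h2 := (isCell_elem K).eq_zero_of_setIntegral_volume_eq_zero
      (continuousOn_innerH2_integrand c τ τ K) (fun x _ => innerH2_integrand_nonneg c τ K x) h1 x hx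
    have h3 := c.frob_compliance_nonneg (stressAt τ K x)
    have h4 := mul_nonneg c.s_pos.le (mul_self_nonneg (ev (τ.1.2 K) x))
    constructor
    · by_contra hne
      have := c.frob_compliance_pos hne
      linarith
    · have h5 : c.s * (ev (τ.1.2 K) x * ev (τ.1.2 K) x) = 0 := by linarith
      simpa [c.s_pos.ne'] using h5
  ext1
  refine Prod.ext ?_ ?_
  · funext i j K
    refine eq_zero_of_ev fun x hx => ?_
    exact congrArg (fun A : symMat d => A.1 i j) (key K x hx).1
  · funext K
    exact eq_zero_of_ev fun x hx => (key K x hx).2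

/-- The inner product of `H₁ × H₂` on the discrete space. -/
def coreForm : M.Core k →ₗ[ℝ] M.Core k →ₗ[ℝ] ℝ :=
  (isBilinearMap_innerH1 c).toLinearMap.compl₁₂ (LinearMap.fst ℝ _ _) (LinearMap.fst ℝ _ _)
    + (isBilinearMap_innerH2 c).toLinearMap.compl₁₂ (LinearMap.snd ℝ _ _) (LinearMap.snd ℝ _ _)

theorem coreForm_apply (x z : M.Core k) :
    coreForm c x z = innerH1 c x.1 z.1 + innerH2 c x.2 z.2 := rfl

theorem coreForm_definite (x : M.Core k) (h : coreForm c x x = 0) : x = 0 := by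
  rw [coreForm_apply] at h
  have h1 := innerH1_self_nonneg c x.1
  have h2 := innerH2_self_nonneg c x.2
  exact Prod.ext (eq_zero_of_innerH1_self c (by linarith)) (eq_zero_of_innerH2_self c (by linarith))

/-- The `L²` inner product on the skeleton. -/
def traceForm : M.traceSpace k →ₗ[ℝ] M.traceSpace k →ₗ[ℝ] ℝ :=
  IsBilinearMap.toLinearMap (f := fun uh vh : M.traceSpace k => ∑ F : M.Face, ∫ x in F.1,
      ∑ a, ∑ i, ev (uh.1 a i F) x * ev (vh.1 a i F) x ∂μHE[d - 1]) <|
    IsBilinearMap.finset_sum fun F _ => isBilinearMap_face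
      (fun x _ => IsBilinearMap.finset_sum fun a _ => IsBilinearMap.finset_sum fun i _ =>
        IsLinearMap.isBilinearMap_mul (isLinearMap_trace a i F x) (isLinearMap_trace a i F x))
      fun uh vh => by
        have := fun f : C((F : Set (Pt d)), ℝ) => continuousOn_ev f
        fun_prop

theorem traceForm_definite (uh : M.traceSpace k) (h : traceForm uh uh = 0) : uh = 0 := by
  have hn : ∀ (F : M.Face) (x : Pt d),
      0 ≤ ∑ a, ∑ i, ev (uh.1 a i F) x * ev (uh.1 a i F) x := fun F x =>
    Finset.sum_nonneg fun a _ => Finset.sum_nonneg fun i _ => mul_self_nonneg _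
  ext1
  funext a i F
  refine eq_zero_of_ev fun x hx => ?_
  have h1 := (Finset.sum_eq_zero_iff_of_nonneg fun F _ => integral_nonneg fun x => hn F x).1 h F
    (Finset.mem_univ F)
  have hc : ContinuousOn (fun x => ∑ a, ∑ i, ev (uh.1 a i F) x * ev (uh.1 a i F) x) F.1 := by
    have := fun f : C((F : Set (Pt d)), ℝ) => continuousOn_ev f
    fun_prop
  have h2 := (isCell_face F).eq_zero_of_setIntegral_eq_zero hc (fun x _ => hn F x) h1 x hx
  have h3 := (Finset.sum_eq_zero_iff_of_nonneg fun a _ => Finset.sum_nonneg fun i _ =>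
    mul_self_nonneg _).1 h2 a (Finset.mem_univ a)
  have h4 := (Finset.sum_eq_zero_iff_of_nonneg fun i _ => mul_self_nonneg _).1 h3 i
    (Finset.mem_univ i)
  exact mul_self_eq_zero.1 h4

theorem isLinearMap_averaged (a : Fin 2) (i : Fin d) (F : M.Face) (x : Pt d) :
    IsLinearMap ℝ fun y : M.Core k => averaged c y a i F x := by
  have hfst : ∀ {f : M.velSpace k → ℝ}, IsLinearMap ℝ f →
      IsLinearMap ℝ fun p : M.Core k => f p.1 := fun hf =>
    ⟨fun _ _ => hf.map_add _ _, fun _ _ => hf.map_smul _ _⟩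
  have hsnd : ∀ {f : M.stressSpace k → ℝ}, IsLinearMap ℝ f →
      IsLinearMap ℝ fun p : M.Core k => f p.2 := fun hf =>
    ⟨fun _ _ => hf.map_add _ _, fun _ _ => hf.map_smul _ _⟩
  unfold averaged mean
  refine IsLinearMap.sub' ((IsLinearMap.finset_sum fun K _ =>
    hfst (isLinearMap_vel a i K x)).div_const _) (IsLinearMap.const_mul ?_ _)
  split_ifs
  · exact (IsLinearMap.finset_sum fun K _ => IsLinearMap.finset_sum fun j _ =>
      (hsnd (isLinearMap_totalStress c K i j x)).mul_const _).div_const _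
  · exact ((IsLinearMap.finset_sum fun K _ =>
      (hsnd (isLinearMap_pressure K x)).mul_const _).div_const _).neg'

theorem continuousOn_averaged (y : M.Core k) (a : Fin 2) (i : Fin d) (F : M.Face) :
    ContinuousOn (averaged c y a i F) F.1 := by
  have h1 : ∀ K ∈ M.elemsOf F, ∀ f : C((K : Set (Pt d)), ℝ), ContinuousOn (ev f) F.1 :=
    fun K hK f => continuousOn_ev_face (mem_elemsOf.1 hK) f
  have h2 : ∀ K ∈ M.elemsOf F, ∀ i j, ContinuousOn (totalStress c y.2 K i j) F.1 :=
    fun K hK i j => (continuousOn_totalStress c y.2 K i j).mono (mem_elemsOf.1 hK)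
  unfold averaged mean
  refine ((continuousOn_finsetSum _ fun K hK => h1 K hK _).div_const _).sub
    (continuousOn_const.mul ?_)
  split_ifs
  · exact (continuousOn_finsetSum _ fun K hK => continuousOn_finsetSum _ fun j _ =>
      (h2 K hK i j).mul continuousOn_const).div_const _
  · exact ((continuousOn_finsetSum _ fun K hK =>
      (h1 K hK _).mul continuousOn_const).div_const _).neg

theorem exists_traceProj :
    ∃ P : M.Core k →ₗ[ℝ] M.traceSpace k, ∀ x, IsTraceProj c x (P x) := by
  have hL : IsBilinearMap ℝ fun (y : M.Core k) (vh : M.traceSpace k) => ∑ F : M.Face, ∫ x in F.1,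
      ∑ a, ∑ i, averaged c y a i F x * ev (vh.1 a i F) x ∂μHE[d - 1] := by
    refine IsBilinearMap.finset_sum fun F _ => isBilinearMap_face (fun x _ => ?_) fun y vh => ?_
    · exact IsBilinearMap.finset_sum fun a _ => IsBilinearMap.finset_sum fun i _ =>
        IsLinearMap.isBilinearMap_mul (isLinearMap_averaged c a i F x) (isLinearMap_trace a i F x)
    · exact continuousOn_finsetSum _ fun a _ => continuousOn_finsetSum _ fun i _ =>
        (continuousOn_averaged c y a i F).mul (continuousOn_ev _)
  obtain ⟨P, hP⟩ := exists_linearMap_of_definite traceForm traceForm_definite hL.toLinearMap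
  exact ⟨P, fun x vh => hP x vh⟩

theorem IsTraceProj.unique {x : M.Core k} {uh uh' : M.traceSpace k} (h : IsTraceProj c x uh)
    (h' : IsTraceProj c x uh') : uh = uh' :=
  eq_of_definite traceForm traceForm_definite fun vh => (h vh).trans (h' vh).symm

/-! ### The algebraic part of the system -/

/-- Multiplication of a skeleton function by a constant on each edge/face. -/
def scaleTrace (w : M.Face → ℝ) (vh : M.traceSpace k) : M.traceSpace k :=
  ⟨fun a i F => w F • vh.1 a i F, fun a i F => Submodule.smul_mem _ _ (vh.2.1 a i F),
    fun i F hF => by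
      change w F • vh.1 0 i F = 0
      rw [vh.2.2 i F hF, smul_zero]⟩

/-- The residual on `F` of the equation defining the trace projection. -/
def traceResidual (x : M.Core k) (uh vh : M.traceSpace k) (F : M.Face) : ℝ :=
  ∫ y in F.1, ∑ a, ∑ i, (averaged c x a i F y - ev (uh.1 a i F) y) * ev (vh.1 a i F) y ∂μHE[d - 1]

theorem isTraceProj_iff (x : M.Core k) (uh : M.traceSpace k) :
    IsTraceProj c x uh ↔ ∀ vh : M.traceSpace k, ∑ F, traceResidual c x uh vh F = 0 := by
  refine forall_congr' fun vh => ?_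
  rw [eq_comm, ← sub_eq_zero, ← Finset.sum_sub_distrib]
  refine Eq.congr (Finset.sum_congr rfl fun F _ => ?_) rfl
  have := fun f : C((F : Set (Pt d)), ℝ) => continuousOn_ev f
  have := fun a i => continuousOn_averaged c x a i F
  rw [← integral_sub]
  · simp only [traceResidual, sub_mul, Finset.sum_sub_distrib]
  · exact (isCell_face F).integrableOn (by fun_prop)
  · exact (isCell_face F).integrableOn (by fun_prop)

/-- Lets a facewise weight be moved into the test function, so that weighted and unweighted
orthogonality to the trace space agree. -/
theorem traceResidual_scaleTrace (x : M.Core k) (uh vh : M.traceSpace k) (w : M.Face → ℝ)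
    (F : M.Face) :
    traceResidual c x uh (scaleTrace w vh) F = w F * traceResidual c x uh vh F := by
  rw [traceResidual, traceResidual, ← integral_const_mul]
  simp only [scaleTrace, ev_smul, Finset.mul_sum, mul_left_comm]

/-- The weight of `F` in the algebraic equations. -/
def faceWeight (M : Mesh Ω) (k : ℕ) (F : M.Face) : ℝ :=
  (M.elemsOf F).card * (((k : ℝ) + 1) ^ 2 / M.hF F)

theorem hF_pos (hd : 1 < d) (F : M.Face) : 0 < M.hF F :=
  (isCell_face F).diam_pos (by omega)

theorem faceWeight_pos (hd : 1 < d) (F : M.Face) : 0 < faceWeight M k F := by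
  have h1 := hF_pos hd F
  have h2 : 0 < ((M.elemsOf F).card : ℝ) := Nat.cast_pos.2 (elemsOf_nonempty F).card_pos
  unfold faceWeight
  positivity

/-- Since `û` and `v̂` are the same from every adjacent element, a sum over the `N` elements
containing `F` is `N` times a mean. Dividing by `N (k+1)² / h_F` leaves the average of `u`, minus
`h_F / (k+1)²` times the average flux, minus `û`. The opposite signs of the stress and pressure
terms in `B_h` account for the sign in the fluid column. -/
theorem algebraic_integrand_eq (hd : 1 < d) (x : M.Core k) (uh vh : M.traceSpace k) (F : M.Face)
    (y : Pt d) :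
    ∑ K ∈ M.elemsOf F, ((∑ i, (∑ j, totalStress c x.2 K i j y * M.normal K F j)
        * ev (vh.1 0 i F) y) - (∑ i, (ev (x.2.1.2 K) y * M.normal K F i) * ev (vh.1 1 i F) y)
      - ((k : ℝ) + 1) ^ 2 / M.hF F * ∑ a, ∑ i, (ev (x.1.1 a i K) y - ev (uh.1 a i F) y)
        * ev (vh.1 a i F) y)
    = -faceWeight M k F *
      ∑ a, ∑ i, (averaged c x a i F y - ev (uh.1 a i F) y) * ev (vh.1 a i F) y := by
  have h1 := (hF_pos hd F).ne'
  have h2 : ((M.elemsOf F).card : ℝ) ≠ 0 := Nat.cast_ne_zero.2 (elemsOf_nonempty F).card_pos.ne'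
  have h3 : ((k : ℝ) + 1) ≠ 0 := by positivity
  simp only [Finset.sum_sub_distrib, Fin.sum_univ_two, mul_add, Finset.sum_add_distrib]
  simp only [Finset.mul_sum]
  simp only [Finset.sum_comm (s := M.elemsOf F)]
  rw [← Finset.sum_add_distrib, ← Finset.sum_add_distrib, ← Finset.sum_sub_distrib,
    ← Finset.sum_sub_distrib]
  refine Finset.sum_congr rfl fun i _ => ?_
  simp only [averaged, mean, faceWeight, if_pos, one_ne_zero, if_false]
  simp only [← Finset.mul_sum, ← Finset.sum_mul, Finset.sum_sub_distrib, Finset.sum_const,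
    nsmul_eq_mul]
  field_simp
  ring

end Mesh

/-! ### The trace equation as an orthogonal projection -/

namespace Mesh

variable {d : ℕ} {Ω : Set (Pt d)} {M : Mesh Ω} {k : ℕ} (c : BiotCoeff d)

theorem Bh_zero_vel (τ : M.stressSpace k) (vh : M.traceSpace k) :
    Bh c τ 0 vh = (∑ K : M.Elem, ∑ F ∈ M.facesOf K, ∫ x in F.1,
        ∑ i, (∑ j, totalStress c τ K i j x * M.normal K F j) * ev (vh.1 0 i F) x ∂μHE[d - 1])
      - ∑ K : M.Elem, ∑ F ∈ M.facesOf K, ∫ x in F.1,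
        ∑ i, (ev (τ.1.2 K) x * M.normal K F i) * ev (vh.1 1 i F) x ∂μHE[d - 1] := by
  have h1 : ∀ (a : Fin 2) (i : Fin d) (K : M.Elem) (x : Pt d),
      ev ((0 : M.velSpace k).1 a i K) x = 0 := fun a i K x => (isLinearMap_vel a i K x).map_zero
  have h2 : ∀ K : M.Elem, ∫ x in K.1, ∑ i, ∑ j,
      totalStress c τ K i j x * strain (0 : M.velSpace k) K i j x = 0 := fun K =>
    setIntegral_eq_zero_of_forall_eq_zero fun x hx => by
      simp [(isLinearMap_strain K _ _ hx).map_zero]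
  have h3 : ∀ K : M.Elem, ∫ x in K.1, ev (τ.1.2 K) x * divFluid (0 : M.velSpace k) K x = 0 :=
    fun K => setIntegral_eq_zero_of_forall_eq_zero fun x hx => by
      simp [(isLinearMap_divFluid K hx).map_zero]
  simp only [Bh, h1, h2, h3, zero_sub, mul_neg, Finset.sum_neg_distrib, integral_neg]
  simp [sub_eq_add_neg]

theorem sum_facesOf_comm (φ : M.Elem → M.Face → ℝ) :
    ∑ K : M.Elem, ∑ F ∈ M.facesOf K, φ K F = ∑ F : M.Face, ∑ K ∈ M.elemsOf F, φ K F :=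
  Finset.sum_comm' fun K F => by simp [mem_facesOf, mem_elemsOf]

/-- Exchanging elements and faces collects on each face the contributions of all adjacent elements,
to which `algebraic_integrand_eq` applies pointwise. -/
theorem algebraic_eq (hd : 1 < d) (x : M.Core k) (uh vh : M.traceSpace k) :
    Bh c x.2 0 vh + stab x.1 uh 0 vh =
      ∑ F : M.Face, -faceWeight M k F * traceResidual c x uh vh F := by
  have h1 : ∀ (a : Fin 2) (i : Fin d) (K : M.Elem) (x : Pt d),
      ev ((0 : M.velSpace k).1 a i K) x = 0 := fun a i K x => (isLinearMap_vel a i K x).map_zero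
  rw [Bh_zero_vel, stab, sum_facesOf_comm, sum_facesOf_comm, sum_facesOf_comm,
    ← Finset.sum_sub_distrib, ← Finset.sum_add_distrib]
  refine Finset.sum_congr rfl fun F _ => ?_
  rw [traceResidual, ← integral_const_mul, ← setIntegral_congr_fun (measurableSet_face F)
    fun y _ => algebraic_integrand_eq c hd x uh vh F y]
  have hc1 : ∀ K ∈ M.elemsOf F, ∀ f : C((K : Set (Pt d)), ℝ), ContinuousOn (ev f) F.1 :=
    fun K hK f => continuousOn_ev_face (mem_elemsOf.1 hK) f
  have hc2 : ∀ K ∈ M.elemsOf F, ∀ i j, ContinuousOn (totalStress c x.2 K i j) F.1 :=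
    fun K hK i j => (continuousOn_totalStress c x.2 K i j).mono (mem_elemsOf.1 hK)
  have hc3 := fun f : C((F : Set (Pt d)), ℝ) => continuousOn_ev f
  have hi1 : ∀ K ∈ M.elemsOf F, IntegrableOn (fun y => ∑ i,
      (∑ j, totalStress c x.2 K i j y * M.normal K F j) * ev (vh.1 0 i F) y) F.1 μHE[d - 1] :=
    fun K hK => (isCell_face F).integrableOn (by
      have := hc2 K hK
      fun_prop)
  have hi2 : ∀ K ∈ M.elemsOf F, IntegrableOn (fun y => ∑ i,
      (ev (x.2.1.2 K) y * M.normal K F i) * ev (vh.1 1 i F) y) F.1 μHE[d - 1] :=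
    fun K hK => (isCell_face F).integrableOn (by
      have := hc1 K hK
      fun_prop)
  have hi3 : ∀ K ∈ M.elemsOf F, IntegrableOn (fun y => ∑ a, ∑ i,
      (ev (x.1.1 a i K) y - ev (uh.1 a i F) y) * ev (vh.1 a i F) y) F.1 μHE[d - 1] :=
    fun K hK => (isCell_face F).integrableOn (by
      have := hc1 K hK
      fun_prop)
  refine Eq.trans ?_ (integral_finsetSum _ fun K hK => ?_).symm
  swap
  · exact ((hi1 K hK).sub (hi2 K hK)).sub ((hi3 K hK).const_mul _)
  rw [← Finset.sum_sub_distrib, ← Finset.sum_add_distrib]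
  refine Finset.sum_congr rfl fun K hK => ?_
  have e1 := integral_sub ((hi1 K hK).sub (hi2 K hK))
    ((hi3 K hK).const_mul (((k : ℝ) + 1) ^ 2 / M.hF F))
  have e2 := integral_sub (hi1 K hK) (hi2 K hK)
  simp only [Pi.sub_apply] at e1
  rw [e1, e2, integral_const_mul]
  simp only [h1, zero_sub, mul_neg, Finset.sum_neg_distrib, integral_neg]
  ring

theorem traceEquation_iff (hd : 1 < d) (x : M.Core k) (uh : M.traceSpace k) :
    TraceEquation c x uh ↔ IsTraceProj c x uh := by
  have hw : ∀ F, faceWeight M k F ≠ 0 := fun F => (faceWeight_pos hd F).ne'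
  rw [isTraceProj_iff, TraceEquation]
  constructor
  · intro h vh
    -- This scaling of the test function cancels the factor `-faceWeight` exactly.
    have := h (scaleTrace (fun F => -(faceWeight M k F)⁻¹) vh)
    rw [algebraic_eq c hd] at this
    rw [← this]
    refine Finset.sum_congr rfl fun F _ => ?_
    rw [traceResidual_scaleTrace, ← mul_assoc, neg_mul_neg, mul_inv_cancel₀ (hw F), one_mul]
  · intro h vh
    rw [algebraic_eq c hd, ← h (scaleTrace (fun F => -faceWeight M k F) vh)]
    exact Finset.sum_congr rfl fun F _ => (traceResidual_scaleTrace c x uh vh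
      (fun F => -faceWeight M k F) F).symm

/-! ### Square-integrable data -/

theorem memLp_ev (K : M.Elem) (q : C((K : Set (Pt d)), ℝ)) :
    MemLp (ev q) 2 (volume.restrict Ω) := by
  have h1 : MemLp (ev q) 2 (volume.restrict (K : Set (Pt d))) := by
    have : IsFiniteMeasure (volume.restrict (K : Set (Pt d))) :=
      ⟨by simpa using (isCell_elem K).isCompact.measure_lt_top⟩
    obtain ⟨C, hC⟩ := (isCell_elem K).isCompact.exists_bound_of_continuousOn (continuousOn_ev q)
    exact MemLp.of_bound ((continuousOn_ev q).aestronglyMeasurable (measurableSet_elem K)) C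
      (ae_restrict_of_forall_mem (measurableSet_elem K) hC)
  have h2 : (K : Set (Pt d)).indicator (ev q) = ev q := by
    refine indicator_eq_self.2 fun x hx => ?_
    by_contra h
    exact hx (ev_of_notMem q h)
  rw [← h2]
  exact ((memLp_indicator_iff_restrict (measurableSet_elem K)).2 h1).restrict _

theorem integrable_mul_ev (w : L2 Ω) (K : M.Elem) (q : C((K : Set (Pt d)), ℝ)) :
    Integrable (fun x => w x * ev q x) (volume.restrict Ω) :=
  (Lp.memLp w).integrable_mul (memLp_ev K q)

theorem integrableOn_mul_ev (w : L2 Ω) (K : M.Elem) (q : C((K : Set (Pt d)), ℝ)) :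
    IntegrableOn (fun x => w x * ev q x) (Ω ∩ K.1) :=
  (integrable_mul_ev w K q).mono_measure (Measure.restrict_mono_set _ inter_subset_left)

/-- Writing the pairing as an `L²` inner product with a fixed element makes its continuity in `w`
evident. -/
theorem setIntegral_mul_ev (hΩ : MeasurableSet Ω) (w : L2 Ω) (K : M.Elem)
    (q : C((K : Set (Pt d)), ℝ)) :
    ∫ x in Ω ∩ K.1, w x * ev q x = inner ℝ ((memLp_ev K q).toLp _) w := by
  have h : ∫ x in Ω, w x * ev q x = ∫ x in Ω ∩ K.1, w x * ev q x :=
    setIntegral_eq_of_subset_of_forall_sdiff_eq_zero hΩ inter_subset_left fun x hx => by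
      rw [ev_of_notMem q fun h => hx.2 ⟨hx.1, h⟩, mul_zero]
  rw [← h, L2.inner_def]
  refine integral_congr_ae ?_
  filter_upwards [(memLp_ev K q).coeFn_toLp] with x hx
  simp [hx]

theorem isLinearMap_setIntegral_mul_ev {V : Type*} [AddCommGroup V] [Module ℝ V] (w : L2 Ω)
    (K : M.Elem) (φ : V →ₗ[ℝ] C((K : Set (Pt d)), ℝ)) :
    IsLinearMap ℝ fun v => ∫ x in Ω ∩ K.1, w x * ev (φ v) x where
  map_add u v := by
    rw [← integral_add (integrableOn_mul_ev w K _) (integrableOn_mul_ev w K _)]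
    simp only [map_add, ev_add, mul_add]
  map_smul r v := by
    rw [smul_eq_mul, ← integral_const_mul]
    simp only [map_smul, ev_smul, mul_left_comm]

theorem load_eq (f : Fin 2 → Fin d → L2 Ω) (g : L2 Ω) (v : M.velSpace k) (τ : M.stressSpace k) :
    load f g v τ = (∑ K : M.Elem, ∑ a, ∑ i, ∫ x in Ω ∩ K.1, f a i x * ev (v.1 a i K) x)
      + ∑ K : M.Elem, ∫ x in Ω ∩ K.1, g x * ev (τ.1.2 K) x := by
  unfold load
  congr 1
  refine Finset.sum_congr rfl fun K _ => ?_
  rw [integral_finsetSum _ fun a _ => integrable_finsetSum _ fun i _ => integrableOn_mul_ev _ K _]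
  exact Finset.sum_congr rfl fun a _ =>
    integral_finsetSum _ fun i _ => integrableOn_mul_ev _ K _

theorem isLinearMap_load (f : Fin 2 → Fin d → L2 Ω) (g : L2 Ω) :
    IsLinearMap ℝ fun z : M.Core k => load f g z.1 z.2 := by
  simp only [load_eq]
  refine IsLinearMap.add' (IsLinearMap.finset_sum fun K _ => IsLinearMap.finset_sum fun a _ =>
    IsLinearMap.finset_sum fun i _ => ?_) (IsLinearMap.finset_sum fun K _ => ?_)
  · exact isLinearMap_setIntegral_mul_ev (f a i) K (V := M.Core k)
      { toFun := fun z => z.1.1 a i K, map_add' := fun _ _ => rfl, map_smul' := fun _ _ => rfl }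
  · exact isLinearMap_setIntegral_mul_ev g K (V := M.Core k)
      { toFun := fun z => z.2.1.2 K, map_add' := fun _ _ => rfl, map_smul' := fun _ _ => rfl }

theorem continuousOn_load (hΩ : MeasurableSet Ω) {S : Set ℝ} {f : ℝ → Fin 2 → Fin d → L2 Ω}
    {g : ℝ → L2 Ω} (hf : ContinuousOn f S) (hg : ContinuousOn g S) (v : M.velSpace k)
    (τ : M.stressSpace k) : ContinuousOn (fun t => load (f t) (g t) v τ) S := by
  simp only [load_eq, setIntegral_mul_ev hΩ]
  refine ContinuousOn.add (continuousOn_finsetSum _ fun K _ => continuousOn_finsetSum _ fun a _ =>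
    continuousOn_finsetSum _ fun i _ => continuousOn_const.inner ?_)
    (continuousOn_finsetSum _ fun K _ => continuousOn_const.inner hg)
  exact continuousOn_pi.1 (continuousOn_pi.1 hf a) i

/-- The `L²` inner product of polynomials on an element. -/
def elemForm (ℓ : ℕ) (K : M.Elem) : M.elemPoly ℓ K →ₗ[ℝ] M.elemPoly ℓ K →ₗ[ℝ] ℝ :=
  IsBilinearMap.toLinearMap (f := fun p q : M.elemPoly ℓ K => ∫ x in K.1, ev p.1 x * ev q.1 x) <|
    IsBilinearMap.setIntegral (measurableSet_elem K)
      (fun _ _ => IsLinearMap.isBilinearMap_mul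
        ⟨fun _ _ => ev_add _ _ _, fun _ _ => ev_smul _ _ _⟩
        ⟨fun _ _ => ev_add _ _ _, fun _ _ => ev_smul _ _ _⟩)
      fun _ _ => (isCell_elem K).integrableOn_volume ((continuousOn_ev _).mul (continuousOn_ev _))

theorem elemForm_definite (ℓ : ℕ) (K : M.Elem) (p : M.elemPoly ℓ K) (h : elemForm ℓ K p p = 0) :
    p = 0 := by
  ext1
  refine eq_zero_of_ev fun x hx => mul_self_eq_zero.1 ?_
  exact (isCell_elem K).eq_zero_of_setIntegral_volume_eq_zero
    ((continuousOn_ev p.1).mul (continuousOn_ev p.1)) (fun x _ => mul_self_nonneg _) h x hx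

theorem exists_isElemProj (ℓ : ℕ) (K : M.Elem) (w : L2 Ω) :
    ∃ p : C((K : Set (Pt d)), ℝ), IsElemProj ℓ K w p := by
  obtain ⟨Q, hQ⟩ := exists_linearMap_of_definite (elemForm ℓ K) (elemForm_definite ℓ K)
    (LinearMap.id : (M.elemPoly ℓ K →ₗ[ℝ] ℝ) →ₗ[ℝ] _)
  have hL := isLinearMap_setIntegral_mul_ev w K (M.elemPoly ℓ K).subtype
  exact ⟨(Q (hL.mk' _)).1, (Q (hL.mk' _)).2, fun q hq => hQ (hL.mk' _) ⟨q, hq⟩⟩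

theorem IsElemProj.unique {ℓ : ℕ} {K : M.Elem} {w : L2 Ω} {p p' : C((K : Set (Pt d)), ℝ)}
    (h : IsElemProj ℓ K w p) (h' : IsElemProj ℓ K w p') : p = p' :=
  congrArg Subtype.val <| eq_of_definite (elemForm ℓ K) (elemForm_definite ℓ K)
    (u := ⟨p, h.1⟩) (v := ⟨p', h'.1⟩) fun z => (h.2 z.1 z.2).trans (h'.2 z.1 z.2).symm

theorem exists_isCoreProj (u0 : Fin 2 → Fin d → L2 Ω) {σ0 : Fin d → Fin d → L2 Ω} (p0 : L2 Ω)
    (hσ : ∀ i j, σ0 i j = σ0 j i) : ∃ x : M.Core k, IsCoreProj u0 σ0 p0 x := by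
  -- Choosing the projection as a function of the datum makes equal data have equal projections, so
  -- symmetry of `σ0` passes to the discrete stress.
  choose Q hQ using fun (ℓ : ℕ) (K : M.Elem) (w : L2 Ω) => exists_isElemProj ℓ K w
  refine ⟨(⟨fun a i K => Q (k + 1) K (u0 a i), fun a i K => (hQ _ _ _).1⟩,
    ⟨(fun i j K => Q k K (σ0 i j), fun K => Q k K p0), fun i j K => (hQ _ _ _).1,
      fun K => (hQ _ _ _).1, fun i j => ?_⟩), fun a i K => hQ _ _ _, fun i j K => hQ _ _ _,
    fun K => hQ _ _ _⟩
  funext K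
  exact congrArg (Q k K) (hσ i j)

theorem IsCoreProj.unique {u0 : Fin 2 → Fin d → L2 Ω} {σ0 : Fin d → Fin d → L2 Ω} {p0 : L2 Ω}
    {x x' : M.Core k} (h : IsCoreProj u0 σ0 p0 x) (h' : IsCoreProj u0 σ0 p0 x') : x = x' := by
  refine Prod.ext (Subtype.ext ?_) (Subtype.ext (Prod.ext ?_ ?_))
  · funext a i K
    exact (h.1 a i K).unique (h'.1 a i K)
  · funext i j K
    exact (h.2.1 i j K).unique (h'.2.1 i j K)
  · funext K
    exact (h.2.2 K).unique (h'.2.2 K)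

end Mesh

/-! ### Reduction of the semi-discrete system to an ODE -/

namespace Mesh

variable {d : ℕ} {Ω : Set (Pt d)} {M : Mesh Ω} {k : ℕ} (c : BiotCoeff d)

/-- The spatial part of the system tested with `v̂ = 0`, with the trace eliminated by `P`. -/
def reducedForm (P : M.Core k →ₗ[ℝ] M.traceSpace k) (x z : M.Core k) : ℝ :=
  damping c x.1 z.1 + Bh c x.2 z.1 0 - Bh c z.2 x.1 (P x) + stab x.1 (P x) z.1 0

theorem isBilinearMap_reducedForm (P : M.Core k →ₗ[ℝ] M.traceSpace k) :
    IsBilinearMap ℝ (reducedForm c P) := by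
  let toPair : M.Core k →ₗ[ℝ] M.velSpace k × M.traceSpace k := (LinearMap.fst ℝ _ _).prod P
  let toVel : M.Core k →ₗ[ℝ] M.velSpace k × M.traceSpace k := (LinearMap.fst ℝ _ _).prod 0
  let D := (isBilinearMap_damping (M := M) (k := k) c).toLinearMap
  let B := (isBilinearMap_Bh (M := M) (k := k) c).toLinearMap
  let S := (isBilinearMap_stab (M := M) (k := k)).toLinearMap
  let L := D.compl₁₂ (LinearMap.fst ℝ _ (M.stressSpace k)) (LinearMap.fst ℝ _ (M.stressSpace k))
    + B.compl₁₂ (LinearMap.snd ℝ (M.velSpace k) _) toVel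
    - (B.compl₁₂ (LinearMap.snd ℝ (M.velSpace k) _) toPair).flip + S.compl₁₂ toPair toVel
  have h : ∀ x z, reducedForm c P x z = L x z := fun _ _ => rfl
  constructor
  · intro x y z; rw [h, h, h, map_add, LinearMap.add_apply]
  · intro r x z; rw [h, h, map_smul, LinearMap.smul_apply]
  · intro x y z; rw [h, h, h, map_add]
  · intro r x z; rw [h, h, map_smul]

/-- By linearity, testing with all triples is the same as testing with `(0, v̂, 0)` and with `(v, 0,
τ)`. The former is the trace equation, whose only solution is `P x`; the latter is the evolution
equation after substitution. -/
theorem system_iff (hd : 1 < d) {P : M.Core k →ₗ[ℝ] M.traceSpace k}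
    (hP : ∀ x, IsTraceProj c x (P x)) (dx x : M.Core k) (uh : M.traceSpace k)
    (f : Fin 2 → Fin d → L2 Ω) (g : L2 Ω) :
    (∀ (v : M.velSpace k) (vh : M.traceSpace k) (τ : M.stressSpace k),
      innerH1 c dx.1 v + innerH2 c dx.2 τ + damping c x.1 v + Bh c x.2 v vh - Bh c τ x.1 uh
        + stab x.1 uh v vh = load f g v τ) ↔
    uh = P x ∧ ∀ z, coreForm c dx z = load f g z.1 z.2 - reducedForm c P x z := by
  have hB : ∀ v vh, Bh c x.2 v vh = Bh c x.2 v 0 + Bh c x.2 0 vh := fun v vh => by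
    have := (isBilinearMap_Bh c).add_right x.2 (v, (0 : M.traceSpace k)) (0, vh)
    simpa using this
  have hS : ∀ v vh, stab x.1 uh v vh = stab x.1 uh v 0 + stab x.1 uh 0 vh := fun v vh => by
    have := isBilinearMap_stab.add_right (x.1, uh) (v, (0 : M.traceSpace k)) (0, vh)
    simpa using this
  have hproj : TraceEquation c x uh ↔ uh = P x := by
    rw [traceEquation_iff c hd]
    exact ⟨fun h => h.unique c (hP x), fun h => h ▸ hP x⟩
  have z1 : innerH1 c dx.1 0 = 0 := ((isBilinearMap_innerH1 c).toLinearMap dx.1).map_zero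
  have z2 : innerH2 c dx.2 0 = 0 := ((isBilinearMap_innerH2 c).toLinearMap dx.2).map_zero
  have z3 : damping c x.1 0 = 0 := ((isBilinearMap_damping c).toLinearMap x.1).map_zero
  have z4 : Bh c 0 x.1 uh = 0 :=
    ((isBilinearMap_Bh c).toLinearMap.flip (x.1, uh)).map_zero
  have z5 : load f g (0 : M.velSpace k) (0 : M.stressSpace k) = 0 := (isLinearMap_load f g).map_zero
  have z6 : Bh c x.2 0 (0 : M.traceSpace k) = 0 :=
    ((isBilinearMap_Bh c).toLinearMap x.2).map_zero
  have z7 : stab x.1 uh 0 0 = 0 := (isBilinearMap_stab.toLinearMap (x.1, uh)).map_zero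
  constructor
  · intro h
    have huh : uh = P x := hproj.1 fun vh => by
      have := h 0 vh 0
      rw [z1, z2, z3, z4, z5] at this
      linarith
    subst huh
    refine ⟨rfl, fun z => ?_⟩
    have := h z.1 0 z.2
    rw [coreForm_apply, reducedForm]
    linarith
  · rintro ⟨huh, h⟩ v vh τ
    have h1 := hproj.2 huh vh
    have h2 := h (v, τ)
    subst huh
    rw [coreForm_apply, reducedForm] at h2
    rw [hB, hS]
    linarith

/-- The matrix of the reduced system. -/
theorem exists_reducedOperator (P : M.Core k →ₗ[ℝ] M.traceSpace k) :
    ∃ A : M.Core k →ₗ[ℝ] M.Core k, ∀ x z, coreForm c (A x) z = -reducedForm c P x z := by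
  obtain ⟨A, hA⟩ := exists_linearMap_of_definite (coreForm c) (coreForm_definite c)
    (-(isBilinearMap_reducedForm c P).toLinearMap)
  exact ⟨A, hA⟩

theorem exists_reducedLoad (hΩ : MeasurableSet Ω) {S : Set ℝ} {f : ℝ → Fin 2 → Fin d → L2 Ω}
    {g : ℝ → L2 Ω} (hf : ContinuousOn f S) (hg : ContinuousOn g S) :
    ∃ b : ℝ → M.Core k, ContinuousOn b S ∧
      ∀ t z, coreForm c (b t) z = load (f t) (g t) z.1 z.2 :=
  exists_continuousOn_of_definite (V := M.Core k) (coreForm c) (coreForm_definite c)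
    (fun t => (isLinearMap_load (f t) (g t)).mk' _) fun z => continuousOn_load hΩ hf hg z.1 z.2

/-- Both `dx` and `A x + b` represent the same functional with respect to `coreForm`, so
definiteness identifies them. -/
theorem solvesHDG_iff (hd : 1 < d) {P : M.Core k →ₗ[ℝ] M.traceSpace k}
    (hP : ∀ x, IsTraceProj c x (P x)) {A : M.Core k →ₗ[ℝ] M.Core k}
    (hA : ∀ x z, coreForm c (A x) z = -reducedForm c P x z) {T : ℝ} (hT : 0 < T)
    {f : ℝ → Fin 2 → Fin d → L2 Ω} {g : ℝ → L2 Ω} {b : ℝ → M.Core k}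
    (hb : ∀ t z, coreForm c (b t) z = load (f t) (g t) z.1 z.2) {y : ℝ → M.Unknown k}
    (hy : ContDiffOn ℝ 1 y (Icc 0 T)) :
    SolvesHDG c T f g y ↔ ∀ t ∈ Icc 0 T, (y t).2 = P (y t).1 ∧
      HasDerivWithinAt (fun r => (y r).1) (A (y t).1 + b t) (Icc 0 T) t := by
  rw [SolvesHDG, and_iff_right hy]
  refine forall₂_congr fun t ht => ?_
  obtain ⟨dx, h2, e1, e2⟩ : ∃ dx : M.Core k,
      (∀ z, HasDerivWithinAt (fun r => (y r).1) z (Icc 0 T) t ↔ dx = z) ∧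
      derivWithin (fun r => (y r).1.1) (Icc 0 T) t = dx.1 ∧
      derivWithin (fun r => (y r).1.2) (Icc 0 T) t = dx.2 :=
    exists_derivWithin_components hT hy ht
  rw [e1, e2, system_iff c hd hP]
  refine and_congr_right fun _ => ?_
  have h3 : ∀ z, coreForm c (A (y t).1 + b t) z
      = load (f t) (g t) z.1 z.2 - reducedForm c P (y t).1 z := fun z => by
    rw [map_add, LinearMap.add_apply, hA, hb]
    ring
  rw [h2]
  constructor
  · exact fun h => eq_of_definite (coreForm c) (coreForm_definite c) fun z => (h z).trans (h3 z).symm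
  · rintro h z
    rw [h, h3]

end Mesh

end PoroHDG

end

/-! ### The main theorem -/

open PoroHDG PoroHDG.Mesh

theorem mainTheorem8 (d : ℕ) (hd : d = 2 ∨ d = 3) (Ω : Set (PoroHDG.Pt d)) (hΩ : IsOpen Ω)
    (hreg : interior (closure Ω) = Ω) (M : PoroHDG.Mesh Ω) (c : PoroHDG.BiotCoeff d) (k : ℕ) :
    -- the discrete spaces are finite-dimensional
    FiniteDimensional ℝ (M.Core k) ∧ FiniteDimensional ℝ (M.traceSpace k) ∧
    -- `P` eliminates the trace, `A` is the matrix of the reduced system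
    ∃ (P : M.Core k →ₗ[ℝ] M.traceSpace k) (A : M.Core k →ₗ[ℝ] M.Core k),
      (∀ x, PoroHDG.Mesh.IsTraceProj c x (P x)) ∧
      ∀ (T : ℝ), 0 < T →
      ∀ (f : ℝ → Fin 2 → Fin d → PoroHDG.Mesh.L2 Ω) (g : ℝ → PoroHDG.Mesh.L2 Ω),
        ContinuousOn f (Set.Icc 0 T) → ContinuousOn g (Set.Icc 0 T) →
        -- the system is equivalent to a linear ODE for `(u, σ, p)`, with the trace eliminated
        (∃ b : ℝ → M.Core k, ContinuousOn b (Set.Icc 0 T) ∧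
          ∀ y : ℝ → M.Unknown k, ContDiffOn ℝ 1 y (Set.Icc 0 T) →
            (PoroHDG.Mesh.SolvesHDG c T f g y ↔
              ∀ t ∈ Set.Icc 0 T, (y t).2 = P (y t).1 ∧
                HasDerivWithinAt (fun r => (y r).1) (A (y t).1 + b t) (Set.Icc 0 T) t)) ∧
        ∀ (u0 : Fin 2 → Fin d → PoroHDG.Mesh.L2 Ω) (σ0 : Fin d → Fin d → PoroHDG.Mesh.L2 Ω)
          (p0 : PoroHDG.Mesh.L2 Ω), (∀ i j, σ0 i j = σ0 j i) →
          -- unique solution with initial values `Π u⁰`, `Π σ⁰`, `Π p⁰`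
          (∃ y : ℝ → M.Unknown k,
            (PoroHDG.Mesh.SolvesHDG c T f g y ∧ PoroHDG.Mesh.IsCoreProj u0 σ0 p0 (y 0).1) ∧
            ∀ y' : ℝ → M.Unknown k,
              PoroHDG.Mesh.SolvesHDG c T f g y' ∧ PoroHDG.Mesh.IsCoreProj u0 σ0 p0 (y' 0).1 →
              Set.EqOn y' y (Set.Icc 0 T)) ∧
          -- if also `û(0) = Π w` is prescribed (`w` being the trace of `u⁰` on the skeleton), there
          -- is a unique solution exactly when the projected data satisfy the trace equation
          ∀ w : M.SkelL2,
            ((∃ y : ℝ → M.Unknown k,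
              (PoroHDG.Mesh.SolvesHDG c T f g y ∧ PoroHDG.Mesh.IsCoreProj u0 σ0 p0 (y 0).1 ∧
                PoroHDG.Mesh.IsSkelProj w (y 0).2) ∧
              ∀ y' : ℝ → M.Unknown k,
                PoroHDG.Mesh.SolvesHDG c T f g y' ∧
                  PoroHDG.Mesh.IsCoreProj u0 σ0 p0 (y' 0).1 ∧
                  PoroHDG.Mesh.IsSkelProj w (y' 0).2 →
                Set.EqOn y' y (Set.Icc 0 T)) ↔
            ∃ (x0 : M.Core k) (uh0 : M.traceSpace k), PoroHDG.Mesh.IsCoreProj u0 σ0 p0 x0 ∧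
              PoroHDG.Mesh.IsSkelProj w uh0 ∧ PoroHDG.Mesh.TraceEquation c x0 uh0) := by
  have hd1 : 1 < d := by omega
  refine ⟨inferInstance, inferInstance, ?_⟩
  obtain ⟨P, hP⟩ := exists_traceProj (M := M) (k := k) c
  obtain ⟨A, hA⟩ := exists_reducedOperator c P
  refine ⟨P, A, hP, fun T hT f g hf hg => ?_⟩
  obtain ⟨b, hbc, hb⟩ := exists_reducedLoad (M := M) (k := k) c hΩ.measurableSet hf hg
  have hiff := fun (y : ℝ → M.Unknown k) (hy : ContDiffOn ℝ 1 y (Set.Icc 0 T)) =>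
    solvesHDG_iff c hd1 hP hA hT hb hy
  refine ⟨⟨b, hbc, hiff⟩, fun u0 σ0 p0 hσ => ?_⟩
  have h0T : (0 : ℝ) ∈ Set.Icc 0 T := ⟨le_rfl, hT.le⟩
  obtain ⟨x0, hx0⟩ := exists_isCoreProj (M := M) (k := k) u0 p0 hσ
  obtain ⟨y, hyc, hyP, hyi, hyu⟩ := 
    existsUnique_solution_of_linear_ode (E := M.Core k) (F := M.traceSpace k) A P hT hbc x0
  have hy : SolvesHDG c T f g y := (hiff y hyc).2 hyP
  have huniq : ∀ y' : ℝ → M.Unknown k, SolvesHDG c T f g y' ∧ IsCoreProj u0 σ0 p0 (y' 0).1 →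
      Set.EqOn y' y (Set.Icc 0 T) := fun y' hy' =>
    hyu y' ((hiff y' hy'.1.1).1 hy'.1) (hy'.2.unique hx0)
  have hy0 : IsCoreProj u0 σ0 p0 (y 0).1 := hyi.symm ▸ hx0
  refine ⟨⟨y, ⟨hy, hy0⟩, huniq⟩, fun w => ⟨?_, ?_⟩⟩
  -- Existence alone forces compatibility: at time zero any solution has trace `P` of its core
  -- value.
  · rintro ⟨z, ⟨hz, hz0, hzw⟩, -⟩
    refine ⟨(z 0).1, (z 0).2, hz0, hzw, (traceEquation_iff c hd1 _ _).2 ?_⟩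
    rw [((hiff z hz.1).1 hz 0 h0T).1]
    exact hP _
  -- The solution with the given core data already has the right initial trace, because
  -- compatibility says that the prescribed trace is `P x1`.
  · rintro ⟨x1, uh1, hx1, hw, htr⟩
    refine ⟨y, ⟨hy, hy0, ?_⟩, fun y' hy' => huniq y' ⟨hy'.1, hy'.2.1⟩⟩
    have h1 : x1 = (y 0).1 := hx1.unique hy0
    have h2 : uh1 = P x1 := ((traceEquation_iff c hd1 _ _).1 htr).unique c (hP x1)
    rwa [(hyP 0 h0T).1, ← h1, ← h2]
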